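/- Let $\mathcal C$ be a non-degenerate braided fusion category over $\mathbb C$ with braiding $\beta$, and let $(A,m,i)$ be a connected étale (i.e. commutative and separable) algebra in $\mathcal C$, connected meaning $\dim \mathcal C(1,A)=1$. Let $\mathcal C_A$ be the monoidal category of right $A$-modules $(M,r)$ with tensor product $M\otimes_A N$, the quotient $\pi_{M,N}\colon M\otimes N\to M\otimes_A N$ which identifies the action of $A$ on $M$ with the action $r_N\circ\beta_{A,N}$ of $A$ on $N$, and let $\mathcal C_A^{\mathrm{loc}}\subset\mathcal C_A$ be the full monoidal subcategory of local modules, those with $r\circ\beta_{A,M}\circ\beta_{M,A}=r$; it is braided by the braiding induced by $\beta$. For a $\mathbb C$-linear braided monoidal category $\mathcal D$ let $\underline{\mathsf{Aut}}^{\mathsf{br}}_\otimes(\mathcal D)$ be the categorical group (a monoidal category under composition) of $\mathbb C$-linear braided monoidal autoequivalences of $\mathcal D$ and monoidal natural isomorphisms. For $(\alpha,\psi^\alpha)\in\underline{\mathsf{Aut}}^{\mathsf{br}}_\otimes(\mathcal C)$ the object $\alpha(A)$ is an algebra with multiplication $\alpha(m)\circ\psi^\alpha_{A,A}$ and unit induced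 by $\alpha(i)$. Let $\underline{\mathsf{Stab}}^{\mathsf{br}}_\otimes(A)$ be the full categorical subgroup of those $\alpha$ with $\alpha(A)\cong A$ as algebras, and let $\underline{\mathsf{Aut}}^{\mathsf{br}}_\otimes(\mathcal C|A)$ be the categorical group whose objects are pairs $(\alpha,\lambda^\alpha)$ of $\alpha\in\underline{\mathsf{Aut}}^{\mathsf{br}}_\otimes(\mathcal C)$ and an algebra isomorphism $\lambda^\alpha\colon\alpha(A)\to A$, whose morphisms $(\alpha,\lambda^\alpha)\to(\gamma,\lambda^\gamma)$ are the monoidal natural isomorphisms $\eta\colon\alpha\Rightarrow\gamma$ with $\lambda^\gamma\circ\eta_A=\lambda^\alpha$, and whose composition is $(\alpha,\lambda^\alpha)\circ(\gamma,\lambda^\gamma)=(\alpha\circ\gamma,\lambda^\alpha\circ\alpha(\lambda^\gamma))$. 1. For every pair $(\alpha,\lambda^\alpha)$ and every local module $(M,r)$ the twisted module $\bigl(\alpha(M),\ \alpha(r)\circ\psi^\alpha_{M,A}\circ(\mathrm{id}_{\alpha(M)}\otimes(\lambda^\alpha)^{-1})\bigr)$ is local. There is a strong monoidal functor $$\underline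 F_A\colon\underline{\mathsf{Aut}}^{\mathsf{br}}_\otimes(\mathcal C|A)\to\underline{\mathsf{Aut}}^{\mathsf{br}}_\otimes(\mathcal C_A^{\mathrm{loc}})$$ which, up to natural isomorphisms that are compatible with all the data that follow, sends $(\alpha,\lambda^\alpha)$ to this twisting functor $(M,r)\mapsto\alpha(M)$, $f\mapsto\alpha(f)$, with the tensorator induced by $\psi^\alpha$ (that is, $\mu_{M,N}\circ\pi_{\alpha(M),\alpha(N)}=\alpha(\pi_{M,N})\circ\psi^\alpha_{M,N}$) and the unit constraint $(\lambda^\alpha)^{-1}\colon A\to\alpha(A)$; which sends $\eta$ to the natural isomorphism with components $\eta_M$; and whose own monoidal constraints are given by the identities of $\alpha(\gamma(M))=(\alpha\circ\gamma)(M)$ and of $M$. 2. Let $G$ be a group and let $(\underline\rho,\mu)\colon\underline G\to\underline{\mathsf{Aut}}^{\mathsf{br}}_\otimes(\mathcal C)$ be a categorical action, i.e. a strong monoidal functor from $G$ regarded as a discrete monoidal category, such that $\underline\rho(g)\in\underline{\mathsf{Stab}}^{\mathsf{br}}_\otimes(A)$ for all $g$; write $g$ for $\underline\rho(g)$. The lifts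 of $(\underline\rho,\mu)$ to $\underline{\mathsf{Aut}}^{\mathsf{br}}_\otimes(\mathcal C|A)$, i.e. the strong monoidal functors $\underline G\to\underline{\mathsf{Aut}}^{\mathsf{br}}_\otimes(\mathcal C|A)$ whose composite with the forgetful monoidal functor $(\alpha,\lambda^\alpha)\mapsto\alpha$ equals $(\underline\rho,\mu)$, are in bijection with the $G$-equivariant algebra structures on $A$, i.e. the families of algebra isomorphisms $\lambda^g\colon g(A)\to A$, $g\in G$, with $\lambda^g\circ g(\lambda^h)=\lambda^{gh}\circ\mu^A_{g,h}$ for all $g,h\in G$. The bijection sends a lift $g\mapsto(g,\lambda^g)$ to the family $(\lambda^g)_{g\in G}$. 3. Consequently every $G$-equivariant algebra structure $\lambda$ on $A$ induces a categorical action $\underline G\to\underline{\mathsf{Aut}}^{\mathsf{br}}_\otimes(\mathcal C_A^{\mathrm{loc}})$, the composite of the corresponding lift with $\underline F_A$: up to the same identifications, $g$ acts by twisting with $(g,\lambda^g)$, and the monoidal constraints are those of $\underline\rho$ at the objects underlying local modules. -/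

import Mathlib

open CategoryTheory MonoidalCategory Limits MonObj

universe v u w


namespace Condensation

section Modules

variable {C : Type u} [Category.{v} C] [MonoidalCategory C]

/-- Right modules over an algebra object. -/
structure RMod (A : C) [MonObj A] where
  X : C
  act : X ⊗ A ⟶ X
  act_one : X ◁ η[A] ≫ act = (ρ_ X).hom
  act_mul : X ◁ μ[A] ≫ act = (α_ X A A).inv ≫ act ▷ A ≫ act

namespace RMod

variable {A : C} [MonObj A]

/-- Morphisms of right modules. -/
@[ext]
structure Hom (M N : RMod A) where
  hom : M.X ⟶ N.X
  comm : M.act ≫ hom = hom ▷ A ≫ N.act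

instance : Category (RMod A) where
  Hom M N := Hom M N
  id M := ⟨𝟙 M.X, by simp⟩
  comp f g := ⟨f.hom ≫ g.hom, by rw [← Category.assoc, f.comm, Category.assoc, g.comm]; simp⟩

@[ext]
lemma hom_ext {M N : RMod A} {f g : M ⟶ N} (h : f.hom = g.hom) : f = g := Hom.ext h

@[simp] lemma id_hom (M : RMod A) : Hom.hom (𝟙 M) = 𝟙 M.X := rfl
@[simp] lemma comp_hom {M N P : RMod A} (f : M ⟶ N) (g : N ⟶ P) :
    Hom.hom (f ≫ g) = f.hom ≫ g.hom := rfl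

/-- An isomorphism of underlying objects which is a module map. -/
@[simps]
def isoMk {M N : RMod A} (e : M.X ≅ N.X) (h : M.act ≫ e.hom = e.hom ▷ A ≫ N.act) : M ≅ N where
  hom := ⟨e.hom, h⟩
  inv := ⟨e.inv, by
    rw [← cancel_mono e.hom, Category.assoc, Category.assoc, h, e.inv_hom_id, Category.comp_id,
      ← Category.assoc, ← comp_whiskerRight, e.inv_hom_id]; simp⟩

section Linear

variable [Preadditive C] [Linear ℂ C] [MonoidalPreadditive C] [MonoidalLinear ℂ C]

/-- The module maps form a linear subspace of all morphisms of underlying objects. -/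
def homSubmodule (M N : RMod A) : Submodule ℂ (M.X ⟶ N.X) where
  carrier := {f | M.act ≫ f = f ▷ A ≫ N.act}
  zero_mem' := by simp
  add_mem' {f g} hf hg := by
    simp only [Set.mem_ofPred_eq] at *
    simp [hf, hg]
  smul_mem' c f hf := by
    simp only [Set.mem_ofPred_eq] at *
    simp [hf]

/-- Morphisms of modules as elements of the subspace of module maps. -/
def homEquiv (M N : RMod A) : (M ⟶ N) ≃ homSubmodule M N where
  toFun f := ⟨f.hom, f.comm⟩
  invFun f := ⟨f.1, f.2⟩

instance (M N : RMod A) : AddCommGroup (M ⟶ N) := (homEquiv M N).addCommGroup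

instance (M N : RMod A) : Module ℂ (M ⟶ N) := (homEquiv M N).module ℂ

lemma add_hom {M N : RMod A} (f g : M ⟶ N) : Hom.hom (f + g) = f.hom + g.hom := rfl
lemma smul_hom {M N : RMod A} (c : ℂ) (f : M ⟶ N) : Hom.hom (c • f) = c • f.hom := rfl

instance : Preadditive (RMod A) where
  add_comp _ _ _ f f' g := by ext; simp [add_hom]
  comp_add _ _ _ f g g' := by ext; simp [add_hom]

instance : Linear ℂ (RMod A) where
  smul_comp _ _ _ c f g := by ext; simp [smul_hom]
  comp_smul _ _ _ f c g := by ext; simp [smul_hom]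

end Linear

section Braided

variable [BraidedCategory C]

/-- The left action on a right module obtained from the half-braiding `β_{A,-}`. -/
def lact (N : RMod A) : A ⊗ N.X ⟶ N.X := (β_ A N.X).hom ≫ N.act

/-- Local (dyslectic) modules: `r ∘ β_{A,M} ∘ β_{M,A} = r`. -/
def IsLocal (M : RMod A) : Prop :=
  (β_ M.X A).hom ≫ (β_ A M.X).hom ≫ M.act = M.act

lemma one_lact (N : RMod A) : η[A] ▷ N.X ≫ N.lact = (λ_ N.X).hom := by
  simp [lact, N.act_one]

lemma act_act (N : RMod A) : N.act ▷ A ≫ N.act = (α_ N.X A A).hom ≫ N.X ◁ μ[A] ≫ N.act := by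
  simp [N.act_mul]

lemma hom_lact {M N : RMod A} (f : M ⟶ N) : M.lact ≫ f.hom = A ◁ f.hom ≫ N.lact := by
  simp [lact, f.comm]

lemma lact_act [IsCommMonObj A] (N : RMod A) :
    N.lact ▷ A ≫ N.act = (α_ A N.X A).hom ≫ A ◁ N.act ≫ N.lact := by
  have h : (β_ A A).hom ≫ μ[A] = μ[A] := IsCommMonObj.mul_comm A
  have e : A ◁ N.act ≫ N.lact = (β_ A (N.X ⊗ A)).hom ≫ N.act ▷ A ≫ N.act := by
    simp [lact]
  rw [e, act_act, lact, comp_whiskerRight, Category.assoc, act_act]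
  simp only [BraidedCategory.braiding_tensor_right_hom, Category.assoc, Iso.inv_hom_id_assoc,
    Iso.hom_inv_id_assoc]
  rw [← MonoidalCategory.whiskerLeft_comp_assoc, h]

lemma mul_lact [IsCommMonObj A] (N : RMod A) :
    μ[A] ▷ N.X ≫ N.lact = (α_ A A N.X).hom ≫ A ◁ N.lact ≫ N.lact := by
  have h : (β_ A A).hom ≫ μ[A] = μ[A] := IsCommMonObj.mul_comm A
  have e : A ◁ N.lact ≫ N.lact =
      (β_ A (A ⊗ N.X)).hom ≫ (β_ A N.X).hom ▷ A ≫ N.act ▷ A ≫ N.act := by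
    rw [← BraidedCategory.braiding_naturality_right_assoc]
    simp [lact]
  rw [e, act_act]
  conv_lhs => rw [← h]
  simp only [comp_whiskerRight, lact, Category.assoc, BraidedCategory.braiding_naturality_left_assoc,
    BraidedCategory.braiding_tensor_left_hom, BraidedCategory.braiding_tensor_right_hom,
    Iso.hom_inv_id_assoc]

section Tensor

variable [HasCoequalizers C] [∀ Z : C, PreservesColimitsOfShape WalkingParallelPair (tensorLeft Z)]

/-- The object underlying the relative tensor product `M ⊗_A N`: the coequalizer of the action of
`A` on `M` and the action of `A` on `N` through the half-braiding. -/
noncomputable def tensX (M N : RMod A) : C :=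
  coequalizer (M.act ▷ N.X) ((α_ M.X A N.X).hom ≫ M.X ◁ N.lact)

/-- The canonical projection `M ⊗ N ⟶ M ⊗_A N`. -/
noncomputable def projX (M N : RMod A) : M.X ⊗ N.X ⟶ tensX M N := coequalizer.π _ _

lemma projX_balanced (M N : RMod A) :
    M.act ▷ N.X ≫ projX M N = (α_ M.X A N.X).hom ≫ M.X ◁ N.lact ≫ projX M N := by
  have := coequalizer.condition (M.act ▷ N.X) ((α_ M.X A N.X).hom ≫ M.X ◁ N.lact)
  rwa [Category.assoc] at this

lemma epi_projX_whiskerRight (M N : RMod A) (Z : C) : Epi (projX M N ▷ Z) :=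
  inferInstanceAs (Epi ((tensorRight Z).map (coequalizer.π _ _)))

variable [IsCommMonObj A]

/-- The right action on `M ⊗_A N`, induced by the action on `N`. -/
noncomputable def tensAct (M N : RMod A) : tensX M N ⊗ A ⟶ tensX M N :=
  Cofork.IsColimit.desc (isColimitOfHasCoequalizerOfPreservesColimit (tensorRight A)
    (M.act ▷ N.X) ((α_ M.X A N.X).hom ≫ M.X ◁ N.lact))
    ((α_ M.X N.X A).hom ≫ M.X ◁ N.act ≫ projX M N) (by
    have h := lact_act N
    have b := projX_balanced M N
    change (M.act ▷ N.X) ▷ A ≫ (α_ M.X N.X A).hom ≫ M.X ◁ N.act ≫ projX M N =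
      ((α_ M.X A N.X).hom ≫ M.X ◁ N.lact) ▷ A ≫ (α_ M.X N.X A).hom ≫ M.X ◁ N.act ≫ projX M N
    calc
      _ = (α_ (M.X ⊗ A) N.X A).hom ≫ (M.X ⊗ A) ◁ N.act ≫ M.act ▷ N.X ≫ projX M N := by
        rw [whisker_exchange_assoc]; simp
      _ = (α_ (M.X ⊗ A) N.X A).hom ≫ (α_ M.X A (N.X ⊗ A)).hom ≫
          M.X ◁ (A ◁ N.act ≫ N.lact) ≫ projX M N := by
        rw [b]; simp
      _ = (α_ (M.X ⊗ A) N.X A).hom ≫ (α_ M.X A (N.X ⊗ A)).hom ≫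
          M.X ◁ ((α_ A N.X A).inv ≫ N.lact ▷ A ≫ N.act) ≫ projX M N := by
        rw [h]; simp
      _ = _ := by simp)

lemma projX_tensAct (M N : RMod A) :
    projX M N ▷ A ≫ tensAct M N = (α_ M.X N.X A).hom ≫ M.X ◁ N.act ≫ projX M N :=
  Cofork.IsColimit.π_desc' (isColimitOfHasCoequalizerOfPreservesColimit (tensorRight A)
    (M.act ▷ N.X) ((α_ M.X A N.X).hom ≫ M.X ◁ N.lact)) _ _

/-- The relative tensor product `M ⊗_A N`. -/
noncomputable def tens (M N : RMod A) : RMod A where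
  X := tensX M N
  act := tensAct M N
  act_one := by
    have := epi_projX_whiskerRight M N (𝟙_ C)
    rw [← cancel_epi (projX M N ▷ 𝟙_ C), ← whisker_exchange_assoc, projX_tensAct,
      associator_naturality_right_assoc, ← MonoidalCategory.whiskerLeft_comp_assoc, N.act_one]
    simp
  act_mul := by
    have := epi_projX_whiskerRight M N (A ⊗ A)
    rw [← cancel_epi (projX M N ▷ (A ⊗ A)), ← whisker_exchange_assoc, projX_tensAct,
      associator_naturality_right_assoc, ← MonoidalCategory.whiskerLeft_comp_assoc, N.act_mul,
      whiskerRight_tensor]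
    simp only [Category.assoc, Iso.hom_inv_id_assoc, ← comp_whiskerRight_assoc, projX_tensAct]
    simp [projX_tensAct]

/-- The canonical projection `M ⊗ N ⟶ M ⊗_A N`. -/
noncomputable def proj (M N : RMod A) : M.X ⊗ N.X ⟶ (tens M N).X := projX M N

lemma proj_balanced (M N : RMod A) :
    M.act ▷ N.X ≫ proj M N = (α_ M.X A N.X).hom ≫ M.X ◁ N.lact ≫ proj M N :=
  projX_balanced M N

lemma proj_act (M N : RMod A) :
    proj M N ▷ A ≫ (tens M N).act = (α_ M.X N.X A).hom ≫ M.X ◁ N.act ≫ proj M N :=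
  projX_tensAct M N

/-- Maps out of the relative tensor product. -/
noncomputable def desc {M N : RMod A} {Q : C} (f : M.X ⊗ N.X ⟶ Q)
    (h : M.act ▷ N.X ≫ f = (α_ M.X A N.X).hom ≫ M.X ◁ N.lact ≫ f) : (tens M N).X ⟶ Q :=
  coequalizer.desc f (by rw [h, Category.assoc])

@[simp] lemma proj_desc {M N : RMod A} {Q : C} (f : M.X ⊗ N.X ⟶ Q)
    (h : M.act ▷ N.X ≫ f = (α_ M.X A N.X).hom ≫ M.X ◁ N.lact ≫ f) : proj M N ≫ desc f h = f :=
  coequalizer.π_desc _ _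

@[simp] lemma proj_desc_assoc {M N : RMod A} {Q R : C} (f : M.X ⊗ N.X ⟶ Q)
    (h : M.act ▷ N.X ≫ f = (α_ M.X A N.X).hom ≫ M.X ◁ N.lact ≫ f) (k : Q ⟶ R) :
    proj M N ≫ desc f h ≫ k = f ≫ k := by
  rw [← Category.assoc, proj_desc]

instance (M N : RMod A) : Epi (proj M N) :=
  inferInstanceAs (Epi (coequalizer.π (M.act ▷ N.X) ((α_ M.X A N.X).hom ≫ M.X ◁ N.lact)))

instance (M N : RMod A) (Z : C) : Epi (proj M N ▷ Z) := epi_projX_whiskerRight M N Z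

instance (M N : RMod A) (Z : C) : Epi (Z ◁ proj M N) :=
  inferInstanceAs (Epi ((tensorLeft Z).map (coequalizer.π _ _)))

instance (M N : RMod A) (Z W : C) : Epi ((proj M N ▷ Z) ▷ W) :=
  inferInstanceAs (Epi ((tensorRight Z ⋙ tensorRight W).map (coequalizer.π _ _)))

instance (M N : RMod A) (Z W : C) : Epi ((Z ◁ proj M N) ▷ W) :=
  inferInstanceAs (Epi ((tensorLeft Z ⋙ tensorRight W).map (coequalizer.π _ _)))

instance (M N : RMod A) (Z W : C) : Epi (W ◁ (proj M N ▷ Z)) :=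
  inferInstanceAs (Epi ((tensorRight Z ⋙ tensorLeft W).map (coequalizer.π _ _)))

instance (M N : RMod A) (Z W : C) : Epi (W ◁ (Z ◁ proj M N)) :=
  inferInstanceAs (Epi ((tensorLeft Z ⋙ tensorLeft W).map (coequalizer.π _ _)))

/-- Maps out of `(M ⊗_A N) ⊗ Z`. -/
noncomputable def descR {M N : RMod A} {Z Q : C} (f : (M.X ⊗ N.X) ⊗ Z ⟶ Q)
    (h : (M.act ▷ N.X) ▷ Z ≫ f = ((α_ M.X A N.X).hom ≫ M.X ◁ N.lact) ▷ Z ≫ f) :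
    (tens M N).X ⊗ Z ⟶ Q :=
  Cofork.IsColimit.desc (isColimitOfHasCoequalizerOfPreservesColimit (tensorRight Z)
    (M.act ▷ N.X) ((α_ M.X A N.X).hom ≫ M.X ◁ N.lact)) f h

@[simp] lemma proj_descR {M N : RMod A} {Z Q : C} (f : (M.X ⊗ N.X) ⊗ Z ⟶ Q)
    (h : (M.act ▷ N.X) ▷ Z ≫ f = ((α_ M.X A N.X).hom ≫ M.X ◁ N.lact) ▷ Z ≫ f) :
    proj M N ▷ Z ≫ descR f h = f :=
  Cofork.IsColimit.π_desc' (isColimitOfHasCoequalizerOfPreservesColimit (tensorRight Z)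
    (M.act ▷ N.X) ((α_ M.X A N.X).hom ≫ M.X ◁ N.lact)) f h

/-- Maps out of `Z ⊗ (M ⊗_A N)`. -/
noncomputable def descL {M N : RMod A} {Z Q : C} (f : Z ⊗ (M.X ⊗ N.X) ⟶ Q)
    (h : Z ◁ (M.act ▷ N.X) ≫ f = Z ◁ ((α_ M.X A N.X).hom ≫ M.X ◁ N.lact) ≫ f) :
    Z ⊗ (tens M N).X ⟶ Q :=
  Cofork.IsColimit.desc (isColimitOfHasCoequalizerOfPreservesColimit (tensorLeft Z)
    (M.act ▷ N.X) ((α_ M.X A N.X).hom ≫ M.X ◁ N.lact)) f h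

@[simp] lemma proj_descL {M N : RMod A} {Z Q : C} (f : Z ⊗ (M.X ⊗ N.X) ⟶ Q)
    (h : Z ◁ (M.act ▷ N.X) ≫ f = Z ◁ ((α_ M.X A N.X).hom ≫ M.X ◁ N.lact) ≫ f) :
    Z ◁ proj M N ≫ descL f h = f :=
  Cofork.IsColimit.π_desc' (isColimitOfHasCoequalizerOfPreservesColimit (tensorLeft Z)
    (M.act ▷ N.X) ((α_ M.X A N.X).hom ≫ M.X ◁ N.lact)) f h

/-- The left action on `M ⊗_A N` is the one induced by the left action on `M`. -/
lemma proj_lact (M N : RMod A) :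
    A ◁ proj M N ≫ (tens M N).lact = (α_ A M.X N.X).inv ≫ M.lact ▷ N.X ≫ proj M N := by
  have b := proj_balanced M N
  have e : A ◁ proj M N ≫ (tens M N).lact =
      (β_ A (M.X ⊗ N.X)).hom ≫ proj M N ▷ A ≫ (tens M N).act := by simp [lact]
  rw [e, proj_act]
  conv_rhs => rw [lact, comp_whiskerRight, Category.assoc, b]
  simp [lact]

lemma tensMap_balanced {M M' N N' : RMod A} (f : M ⟶ M') (g : N ⟶ N') :
    M.act ▷ N.X ≫ (f.hom ⊗ₘ g.hom) ≫ proj M' N' =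
      (α_ M.X A N.X).hom ≫ M.X ◁ N.lact ≫ (f.hom ⊗ₘ g.hom) ≫ proj M' N' := by
  have h1 := proj_balanced M' N'
  have h2 := hom_lact g
  have h3 := f.comm
  calc
    _ = ((f.hom ▷ A) ⊗ₘ g.hom) ≫ M'.act ▷ N'.X ≫ proj M' N' := by
      simp only [MonoidalCategory.tensorHom_def', Category.assoc, ← comp_whiskerRight_assoc, ← h3,
        whisker_exchange_assoc]
    _ = (α_ M.X A N.X).hom ≫ (f.hom ⊗ₘ (N.lact ≫ g.hom)) ≫ proj M' N' := by
      rw [h1, h2]; simp [MonoidalCategory.tensorHom_def]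
    _ = _ := by simp [MonoidalCategory.tensorHom_def']

/-- The functoriality of the relative tensor product. -/
noncomputable def tensMap {M M' N N' : RMod A} (f : M ⟶ M') (g : N ⟶ N') :
    tens M N ⟶ tens M' N' where
  hom := desc ((f.hom ⊗ₘ g.hom) ≫ proj M' N') (tensMap_balanced f g)
  comm := by
    rw [← cancel_epi (proj M N ▷ A), ← Category.assoc, proj_act, ← comp_whiskerRight_assoc,
      proj_desc]
    simp only [comp_whiskerRight, Category.assoc, proj_act, proj_desc,
      MonoidalCategory.tensorHom_def]
    rw [whisker_exchange_assoc, ← MonoidalCategory.whiskerLeft_comp_assoc, g.comm]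
    simp

@[simp] lemma proj_tensMap {M M' N N' : RMod A} (f : M ⟶ M') (g : N ⟶ N') :
    proj M N ≫ (tensMap f g).hom = (f.hom ⊗ₘ g.hom) ≫ proj M' N' :=
  proj_desc _ (tensMap_balanced f g)

@[simp] lemma proj_tensMap_assoc {M M' N N' : RMod A} (f : M ⟶ M') (g : N ⟶ N') {Q : C}
    (k : (tens M' N').X ⟶ Q) :
    proj M N ≫ (tensMap f g).hom ≫ k = (f.hom ⊗ₘ g.hom) ≫ proj M' N' ≫ k := by
  rw [← Category.assoc, proj_tensMap, Category.assoc]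

lemma tens_ext {M N P : RMod A} {f g : tens M N ⟶ P}
    (h : proj M N ≫ f.hom = proj M N ≫ g.hom) : f = g := by
  ext; exact (cancel_epi _).1 h

lemma tens_ext₃ {M N P Q : RMod A} {f g : tens (tens M N) P ⟶ Q}
    (h : proj M N ▷ P.X ≫ proj (tens M N) P ≫ f.hom =
      proj M N ▷ P.X ≫ proj (tens M N) P ≫ g.hom) : f = g :=
  tens_ext ((cancel_epi _).1 h)

variable (A) in
/-- The regular module, which is the tensor unit. -/
abbrev regular : RMod A where
  X := A
  act := μ[A]
  act_one := by simp
  act_mul := by simp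

lemma regular_lact : (regular A).lact = μ[A] := IsCommMonObj.mul_comm A

lemma act_balanced (M : RMod A) : M.act ▷ (regular A).X ≫ M.act =
    (α_ M.X A (regular A).X).hom ≫ M.X ◁ (regular A).lact ≫ M.act := by
  rw [regular_lact]; exact M.act_act

/-- The left unitor, given by the left action. -/
noncomputable def leftUnitorHom (M : RMod A) : tens (regular A) M ⟶ M where
  hom := desc M.lact (mul_lact M)
  comm := by
    rw [← cancel_epi (proj _ M ▷ A), ← Category.assoc, proj_act, ← comp_whiskerRight_assoc,
      proj_desc]
    simp [lact_act]

/-- The right unitor, given by the action. -/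
noncomputable def rightUnitorHom (M : RMod A) : tens M (regular A) ⟶ M where
  hom := desc M.act (act_balanced M)
  comm := by
    rw [← cancel_epi (proj M _ ▷ A), ← Category.assoc, proj_act, ← comp_whiskerRight_assoc,
      proj_desc]
    simp [act_act]

@[simp] lemma proj_leftUnitorHom (M : RMod A) :
    proj (regular A) M ≫ (leftUnitorHom M).hom = M.lact := proj_desc _ (mul_lact M)

@[simp] lemma proj_rightUnitorHom (M : RMod A) :
    proj M (regular A) ≫ (rightUnitorHom M).hom = M.act := proj_desc _ (act_balanced M)

/-- The left unitor. -/
noncomputable def lUnitor (M : RMod A) : tens (regular A) M ≅ M :=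
  isoMk { hom := (leftUnitorHom M).hom
          inv := (λ_ M.X).inv ≫ η[A] ▷ M.X ≫ proj (regular A) M
          hom_inv_id := by
            have b := proj_balanced (regular A) M
            rw [← cancel_epi (proj _ M), ← Category.assoc, proj_leftUnitorHom]
            have : M.lact ≫ (λ_ M.X).inv ≫ η[A] ▷ M.X =
              (λ_ _).inv ≫ η[A] ▷ (A ⊗ M.X) ≫ A ◁ M.lact := by
              rw [← whisker_exchange]; simp
            rw [reassoc_of% this]
            have b' : A ◁ M.lact ≫ proj (regular A) M =
              (α_ A A M.X).inv ≫ μ[A] ▷ M.X ≫ proj (regular A) M := by rw [b]; simp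
            rw [b']
            have : (λ_ (A ⊗ M.X)).inv ≫ η[A] ▷ (A ⊗ M.X) ≫ (α_ A A M.X).inv ≫ μ[A] ▷ M.X =
              𝟙 _ := by
              have := MonObj.one_mul A
              rw [whiskerRight_tensor]
              simp [← comp_whiskerRight]
            rw [reassoc_of% this]; simp
          inv_hom_id := by
            simp only [Category.assoc, proj_leftUnitorHom]
            rw [one_lact]; simp } (leftUnitorHom M).comm

/-- The right unitor. -/
noncomputable def rUnitor (M : RMod A) : tens M (regular A) ≅ M :=
  isoMk { hom := (rightUnitorHom M).hom
          inv := (ρ_ M.X).inv ≫ M.X ◁ η[A] ≫ proj M (regular A)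
          hom_inv_id := by
            have b := proj_balanced M (regular A)
            rw [← cancel_epi (proj M _), ← Category.assoc, proj_rightUnitorHom]
            have : M.act ≫ (ρ_ M.X).inv ≫ M.X ◁ η[A] =
              (ρ_ _).inv ≫ (M.X ⊗ A) ◁ η[A] ≫ M.act ▷ A := by
              rw [whisker_exchange]; simp
            rw [reassoc_of% this, b, regular_lact]
            simp [← MonoidalCategory.whiskerLeft_comp_assoc]
          inv_hom_id := by
            simp only [Category.assoc, proj_rightUnitorHom]
            rw [M.act_one]; simp } (rightUnitorHom M).comm

@[simp] lemma proj_lUnitor (M : RMod A) :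
    proj (regular A) M ≫ (lUnitor M).hom.hom = M.lact := proj_leftUnitorHom M

@[simp] lemma proj_rUnitor (M : RMod A) :
    proj M (regular A) ≫ (rUnitor M).hom.hom = M.act := proj_rightUnitorHom M

/-- Descending `(M ⊗ N) ⊗ P ⟶ M ⊗_A (N ⊗_A P)` in the first two variables. -/
noncomputable def assocHomAux (M N P : RMod A) : (tens M N).X ⊗ P.X ⟶ (tens M (tens N P)).X :=
  descR ((α_ M.X N.X P.X).hom ≫ M.X ◁ proj N P ≫ proj M (tens N P)) (by
    have b := proj_balanced M (tens N P)
    have l := proj_lact N P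
    calc
      _ = (α_ (M.X ⊗ A) N.X P.X).hom ≫ (M.X ⊗ A) ◁ proj N P ≫ M.act ▷ _ ≫
          proj M (tens N P) := by rw [whisker_exchange_assoc]; simp
      _ = (α_ (M.X ⊗ A) N.X P.X).hom ≫ (α_ M.X A _).hom ≫
          M.X ◁ (A ◁ proj N P ≫ (tens N P).lact) ≫ proj M (tens N P) := by rw [b]; simp
      _ = _ := by rw [l]; simp)

@[simp] lemma proj_assocHomAux (M N P : RMod A) : proj M N ▷ P.X ≫ assocHomAux M N P =
    (α_ M.X N.X P.X).hom ≫ M.X ◁ proj N P ≫ proj M (tens N P) := proj_descR _ _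

/-- Descending `M ⊗ (N ⊗ P) ⟶ (M ⊗_A N) ⊗_A P` in the last two variables. -/
noncomputable def assocInvAux (M N P : RMod A) : M.X ⊗ (tens N P).X ⟶ (tens (tens M N) P).X :=
  descL ((α_ M.X N.X P.X).inv ≫ proj M N ▷ P.X ≫ proj (tens M N) P) (by
    have b := proj_balanced (tens M N) P
    have l := proj_act M N
    calc
      _ = (α_ M.X (N.X ⊗ A) P.X).inv ≫ (α_ M.X N.X A).inv ▷ P.X ≫
          ((α_ M.X N.X A).hom ≫ M.X ◁ N.act ≫ proj M N) ▷ P.X ≫ proj (tens M N) P := by simp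
      _ = (α_ M.X (N.X ⊗ A) P.X).inv ≫ (α_ M.X N.X A).inv ▷ P.X ≫ (proj M N ▷ A) ▷ P.X ≫
          (α_ _ A P.X).hom ≫ (tens M N).X ◁ P.lact ≫ proj (tens M N) P := by
        rw [← l, comp_whiskerRight_assoc, b]
      _ = _ := by
        rw [associator_naturality_left_assoc, ← whisker_exchange_assoc]
        simp)

@[simp] lemma proj_assocInvAux (M N P : RMod A) : M.X ◁ proj N P ≫ assocInvAux M N P =
    (α_ M.X N.X P.X).inv ≫ proj M N ▷ P.X ≫ proj (tens M N) P := proj_descL _ _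

/-- The associator, as a morphism of underlying objects. -/
noncomputable def assocHom (M N P : RMod A) : (tens (tens M N) P).X ⟶ (tens M (tens N P)).X :=
  desc (assocHomAux M N P) (by
    rw [← cancel_epi ((proj M N ▷ A) ▷ P.X), ← comp_whiskerRight_assoc, proj_act]
    have b := proj_balanced N P
    calc
      _ = (α_ M.X N.X A).hom ▷ P.X ≫ (M.X ◁ N.act) ▷ P.X ≫ proj M N ▷ P.X ≫
          assocHomAux M N P := by simp
      _ = (α_ M.X N.X A).hom ▷ P.X ≫ (α_ M.X (N.X ⊗ A) P.X).hom ≫ M.X ◁ (N.act ▷ P.X ≫ proj N P) ≫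
          proj M (tens N P) := by rw [proj_assocHomAux]; simp
      _ = (α_ (M.X ⊗ N.X) A P.X).hom ≫ (M.X ⊗ N.X) ◁ P.lact ≫ proj M N ▷ P.X ≫
          assocHomAux M N P := by rw [b, proj_assocHomAux]; simp
      _ = _ := by
        rw [associator_naturality_left_assoc, ← whisker_exchange_assoc])

@[simp] lemma proj_assocHom (M N P : RMod A) :
    proj (tens M N) P ≫ assocHom M N P = assocHomAux M N P := proj_desc _ _

@[simp] lemma proj_assocHom_assoc (M N P : RMod A) {Q : C} (k : (tens M (tens N P)).X ⟶ Q) :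
    proj (tens M N) P ≫ assocHom M N P ≫ k = assocHomAux M N P ≫ k := by
  rw [← Category.assoc, proj_assocHom]

/-- The inverse of the associator, as a morphism of underlying objects. -/
noncomputable def assocInv (M N P : RMod A) : (tens M (tens N P)).X ⟶ (tens (tens M N) P).X :=
  desc (assocInvAux M N P) (by
    rw [← cancel_epi ((M.X ⊗ A) ◁ proj N P)]
    have b := proj_balanced M N
    have l := proj_lact N P
    calc
      _ = M.act ▷ _ ≫ M.X ◁ proj N P ≫ assocInvAux M N P := by rw [whisker_exchange_assoc]
      _ = (α_ (M.X ⊗ A) N.X P.X).inv ≫ (M.act ▷ N.X ≫ proj M N) ▷ P.X ≫ proj (tens M N) P := by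
        rw [proj_assocInvAux]; simp
      _ = (α_ M.X A (N.X ⊗ P.X)).hom ≫ M.X ◁ (α_ A N.X P.X).inv ≫ M.X ◁ (N.lact ▷ P.X) ≫
            M.X ◁ proj N P ≫ assocInvAux M N P := by
        rw [b, proj_assocInvAux]; simp
      _ = (α_ M.X A (N.X ⊗ P.X)).hom ≫ M.X ◁ (A ◁ proj N P ≫ (tens N P).lact) ≫
            assocInvAux M N P := by rw [l]; simp
      _ = _ := by simp)

@[simp] lemma proj_assocInv (M N P : RMod A) :
    proj M (tens N P) ≫ assocInv M N P = assocInvAux M N P := proj_desc _ _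

/-- The associator. -/
noncomputable def assoc (M N P : RMod A) : tens (tens M N) P ≅ tens M (tens N P) :=
  isoMk { hom := assocHom M N P
          inv := assocInv M N P
          hom_inv_id := by
            rw [← cancel_epi (proj _ _), ← cancel_epi (proj M N ▷ P.X), proj_assocHom_assoc,
              ← Category.assoc, proj_assocHomAux]
            simp
          inv_hom_id := by
            rw [← cancel_epi (proj _ _), ← cancel_epi (M.X ◁ proj N P), ← Category.assoc (proj _ _),
              proj_assocInv, ← Category.assoc, proj_assocInvAux]
            simp } (by
    change (tens (tens M N) P).act ≫ assocHom M N P =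
      assocHom M N P ▷ A ≫ (tens M (tens N P)).act
    rw [← cancel_epi (proj (tens M N) P ▷ A), ← cancel_epi ((proj M N ▷ P.X) ▷ A)]
    rw [← Category.assoc (proj _ _ ▷ A), proj_act, ← comp_whiskerRight_assoc (proj _ _), proj_assocHom,
      ← comp_whiskerRight_assoc, proj_assocHomAux]
    simp only [Category.assoc, proj_assocHom]
    rw [associator_naturality_left_assoc, ← whisker_exchange_assoc, proj_assocHomAux]
    simp only [comp_whiskerRight, Category.assoc, proj_act]
    rw [associator_naturality_middle_assoc, ← MonoidalCategory.whiskerLeft_comp_assoc, proj_act]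
    simp)

@[simp] lemma assoc_hom_hom (M N P : RMod A) : (assoc M N P).hom.hom = assocHom M N P := rfl

lemma proj_assoc (M N P : RMod A) :
    proj M N ▷ P.X ≫ proj (tens M N) P ≫ (assoc M N P).hom.hom =
      (α_ M.X N.X P.X).hom ≫ M.X ◁ proj N P ≫ proj M (tens N P) := by
  rw [assoc_hom_hom, proj_assocHom, proj_assocHomAux]

noncomputable instance : MonoidalCategoryStruct (RMod A) where
  tensorObj := tens
  tensorHom := tensMap
  whiskerLeft M _ _ f := tensMap (𝟙 M) f
  whiskerRight f N := tensMap f (𝟙 N)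
  tensorUnit := regular A
  associator := assoc
  leftUnitor := lUnitor
  rightUnitor := rUnitor

lemma proj_tensMap_tensorHom {M M' N N' : RMod A} (f : M ⟶ M') (g : N ⟶ N') {X Y : C} (k : X ⟶ Y) :
    proj M N ▷ X ≫ ((tensMap f g).hom ⊗ₘ k) = ((f.hom ⊗ₘ g.hom) ⊗ₘ k) ≫ proj M' N' ▷ Y := by
  rw [← tensorHom_id, tensorHom_comp_tensorHom, proj_tensMap, Category.id_comp,
    ← tensorHom_id, tensorHom_comp_tensorHom, Category.comp_id]

lemma tensorHom_proj_tensMap {M M' N N' : RMod A} (f : M ⟶ M') (g : N ⟶ N') {X Y : C} (k : X ⟶ Y) :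
    X ◁ proj M N ≫ (k ⊗ₘ (tensMap f g).hom) = (k ⊗ₘ (f.hom ⊗ₘ g.hom)) ≫ Y ◁ proj M' N' := by
  rw [← id_tensorHom, tensorHom_comp_tensorHom, proj_tensMap, Category.id_comp,
    ← id_tensorHom, tensorHom_comp_tensorHom, Category.comp_id]

noncomputable instance : MonoidalCategory (RMod A) :=
  MonoidalCategory.ofTensorHom
    (id_tensorHom_id := by
      intro M N
      change tensMap (𝟙 M) (𝟙 N) = 𝟙 (tens M N)
      apply tens_ext; simp)
    (tensorHom_comp_tensorHom := by
      intro M N P M' N' P' f f' g g'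
      change tensMap f f' ≫ tensMap g g' = tensMap (f ≫ g) (f' ≫ g')
      apply tens_ext; simp)
    (associator_naturality := by
      intro M N P M' N' P' f g k
      change tensMap (tensMap f g) k ≫ (assoc _ _ _).hom =
        (assoc _ _ _).hom ≫ tensMap f (tensMap g k)
      apply tens_ext₃
      simp only [comp_hom, proj_tensMap_assoc, reassoc_of% proj_assoc,
        reassoc_of% proj_tensMap_tensorHom, proj_assoc, proj_tensMap,
        reassoc_of% tensorHom_proj_tensMap]
      rw [associator_naturality_assoc])
    (leftUnitor_naturality := by
      intro M N f
      change tensMap (𝟙 (regular A)) f ≫ (lUnitor _).hom = (lUnitor _).hom ≫ f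
      apply tens_ext
      simp only [comp_hom, proj_tensMap_assoc, proj_lUnitor]
      rw [← Category.assoc (proj _ _), proj_lUnitor, hom_lact, id_hom, id_tensorHom])
    (rightUnitor_naturality := by
      intro M N f
      change tensMap f (𝟙 (regular A)) ≫ (rUnitor _).hom = (rUnitor _).hom ≫ f
      apply tens_ext
      simp only [comp_hom, proj_tensMap_assoc, proj_rUnitor]
      rw [← Category.assoc (proj _ _), proj_rUnitor, f.comm, id_hom, tensorHom_id])
    (pentagon := by
      intro W X Y Z
      change tensMap (assoc W X Y).hom (𝟙 Z) ≫ (assoc W (tens X Y) Z).hom ≫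
        tensMap (𝟙 W) (assoc X Y Z).hom = (assoc (tens W X) Y Z).hom ≫ (assoc W X (tens Y Z)).hom
      apply tens_ext₃
      rw [← cancel_epi ((proj W X ▷ Y.X) ▷ Z.X)]
      simp only [comp_hom, proj_tensMap_assoc, reassoc_of% proj_assoc, id_hom, tensorHom_id]
      simp only [← comp_whiskerRight_assoc, proj_assoc]
      simp only [comp_whiskerRight, Category.assoc, reassoc_of% proj_assoc, proj_tensMap,
        id_hom, id_tensorHom]
      simp only [associator_naturality_middle_assoc, ← MonoidalCategory.whiskerLeft_comp_assoc,
        proj_assoc, associator_naturality_left_assoc]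
      rw [← whisker_exchange_assoc, proj_assoc]
      simp)
    (triangle := by
      intro M N
      change (assoc M (regular A) N).hom ≫ tensMap (𝟙 M) (lUnitor N).hom =
        tensMap (rUnitor M).hom (𝟙 N)
      apply tens_ext₃
      simp only [comp_hom, reassoc_of% proj_assoc, proj_tensMap, id_hom, id_tensorHom,
        tensorHom_id, ← MonoidalCategory.whiskerLeft_comp_assoc, ← comp_whiskerRight_assoc,
        proj_lUnitor, proj_rUnitor]
      exact (proj_balanced M N).symm)

lemma isLocal_regular : (regular A).IsLocal := by
  have h : (β_ A A).hom ≫ μ[A] = μ[A] := IsCommMonObj.mul_comm A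
  change (β_ A A).hom ≫ (β_ A A).hom ≫ μ[A] = μ[A]
  rw [h, h]

lemma isLocal_tens {M N : RMod A} (hM : M.IsLocal) (hN : N.IsLocal) : (M.tens N).IsLocal := by
  have b := proj_balanced M N
  have e : proj M N ▷ A ≫ (β_ (tens M N).X A).hom ≫ (β_ A (tens M N).X).hom =
      (β_ (M.X ⊗ N.X) A).hom ≫ (β_ A (M.X ⊗ N.X)).hom ≫ proj M N ▷ A := by simp
  unfold IsLocal
  rw [← cancel_epi (proj M N ▷ A), reassoc_of% e, proj_act]
  calc
    _ = (β_ (M.X ⊗ N.X) A).hom ≫ (α_ A M.X N.X).inv ≫ (β_ A M.X).hom ▷ N.X ≫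
        (α_ M.X A N.X).hom ≫ M.X ◁ N.lact ≫ proj M N := by simp [lact]
    _ = (α_ M.X N.X A).hom ≫ M.X ◁ (β_ N.X A).hom ≫ (α_ M.X A N.X).inv ≫
        ((β_ M.X A).hom ≫ (β_ A M.X).hom ≫ M.act) ▷ N.X ≫ proj M N := by rw [← b]; simp
    _ = (α_ M.X N.X A).hom ≫ M.X ◁ ((β_ N.X A).hom ≫ (β_ A N.X).hom ≫ N.act) ≫ proj M N := by
      rw [hM, b]; simp [lact]
    _ = _ := by rw [hN]

lemma braid_balanced {M N : RMod A} (hM : M.IsLocal) :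
    M.act ▷ N.X ≫ (β_ M.X N.X).hom ≫ proj N M =
      (α_ M.X A N.X).hom ≫ M.X ◁ N.lact ≫ (β_ M.X N.X).hom ≫ proj N M := by
  have b := proj_balanced N M
  symm
  calc
    _ = (α_ M.X A N.X).hom ≫ (β_ M.X (A ⊗ N.X)).hom ≫ (β_ A N.X).hom ▷ M.X ≫
        N.act ▷ M.X ≫ proj N M := by
      rw [BraidedCategory.braiding_naturality_right_assoc]; simp [lact]
    _ = (β_ M.X A).hom ▷ N.X ≫ (β_ (A ⊗ M.X) N.X).hom ≫ N.X ◁ (β_ A M.X).hom ≫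
        N.X ◁ M.act ≫ proj N M := by rw [b]; simp [lact]
    _ = (β_ (M.X ⊗ A) N.X).hom ≫ N.X ◁ ((β_ M.X A).hom ≫ (β_ A M.X).hom ≫ M.act) ≫ proj N M := by
      rw [BraidedCategory.braiding_naturality_left_assoc]; simp
    _ = _ := by rw [hM, BraidedCategory.braiding_naturality_left_assoc]

lemma braidInv_balanced {M N : RMod A} (hM : M.IsLocal) :
    N.act ▷ M.X ≫ (β_ M.X N.X).inv ≫ proj M N =
      (α_ N.X A M.X).hom ≫ N.X ◁ M.lact ≫ (β_ M.X N.X).inv ≫ proj M N := by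
  have b := proj_balanced M N
  rw [← cancel_epi (β_ M.X (N.X ⊗ A)).hom]
  symm
  calc
    _ = (α_ M.X N.X A).inv ≫ (β_ M.X N.X).hom ▷ A ≫ (α_ N.X M.X A).hom ≫
        N.X ◁ ((β_ M.X A).hom ≫ (β_ A M.X).hom ≫ M.act) ≫ (β_ M.X N.X).inv ≫ proj M N := by
      simp [lact]
    _ = (α_ M.X N.X A).inv ≫ (β_ M.X N.X).hom ▷ A ≫ (α_ N.X M.X A).hom ≫
        (β_ (M.X ⊗ A) N.X).inv ≫ M.act ▷ N.X ≫ proj M N := by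
      rw [hM, BraidedCategory.braiding_inv_naturality_right_assoc]
    _ = M.X ◁ N.act ≫ proj M N := by rw [b]; simp [lact]
    _ = _ := by rw [← BraidedCategory.braiding_naturality_right_assoc]; simp

lemma braid_comm {M N : RMod A} (hM : M.IsLocal) :
    (α_ M.X N.X A).hom ≫ M.X ◁ N.act ≫ (β_ M.X N.X).hom ≫ proj N M =
      (β_ M.X N.X).hom ▷ A ≫ (α_ N.X M.X A).hom ≫ N.X ◁ M.act ≫ proj N M := by
  have b := proj_balanced N M
  calc
    _ = (α_ M.X N.X A).hom ≫ (β_ M.X (N.X ⊗ A)).hom ≫ N.act ▷ M.X ≫ proj N M := by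
      rw [BraidedCategory.braiding_naturality_right_assoc]
    _ = (β_ M.X N.X).hom ▷ A ≫ (α_ N.X M.X A).hom ≫
        N.X ◁ ((β_ M.X A).hom ≫ (β_ A M.X).hom ≫ M.act) ≫ proj N M := by rw [b]; simp [lact]
    _ = _ := by rw [hM]

/-- The braiding of `C` descends to relative tensor products of local modules. -/
noncomputable def braid (M N : RMod A) (hM : M.IsLocal) : tens M N ≅ tens N M :=
  isoMk { hom := desc ((β_ M.X N.X).hom ≫ proj N M) (braid_balanced hM)
          inv := desc ((β_ M.X N.X).inv ≫ proj M N) (braidInv_balanced hM)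
          hom_inv_id := by rw [← cancel_epi (proj _ _)]; simp
          inv_hom_id := by rw [← cancel_epi (proj _ _)]; simp } (by
    rw [← cancel_epi (proj M N ▷ A), ← Category.assoc, proj_act, ← comp_whiskerRight_assoc]
    simp only [Category.assoc, proj_desc, comp_whiskerRight, proj_act]
    exact braid_comm hM)

@[simp] lemma proj_braid (M N : RMod A) (hM : M.IsLocal) :
    proj M N ≫ (braid M N hM).hom.hom = (β_ M.X N.X).hom ≫ proj N M :=
  proj_desc _ (braid_balanced hM)

lemma proj_assoc_inv (M N P : RMod A) :
    M.X ◁ proj N P ≫ proj M (tens N P) ≫ (assoc M N P).inv.hom =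
      (α_ M.X N.X P.X).inv ≫ proj M N ▷ P.X ≫ proj (tens M N) P := by
  change M.X ◁ proj N P ≫ proj M (tens N P) ≫ assocInv M N P = _
  rw [proj_assocInv, proj_assocInvAux]

lemma tens_ext₃' {M N P Q : RMod A} {f g : tens M (tens N P) ⟶ Q}
    (h : M.X ◁ proj N P ≫ proj M (tens N P) ≫ f.hom =
      M.X ◁ proj N P ≫ proj M (tens N P) ≫ g.hom) : f = g :=
  tens_ext ((cancel_epi _).1 h)

lemma braid_naturality {M M' N N' : RMod A} (hM : M.IsLocal) (hM' : M'.IsLocal)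
    (f : M ⟶ M') (g : N ⟶ N') :
    tensMap f g ≫ (braid M' N' hM').hom = (braid M N hM).hom ≫ tensMap g f := by
  apply tens_ext
  simp only [comp_hom, proj_tensMap_assoc, proj_braid, reassoc_of% proj_braid, proj_tensMap]
  rw [BraidedCategory.braiding_naturality_assoc]

lemma hexagon₁ (X Y Z : RMod A) (hX : X.IsLocal) :
    (assoc X Y Z).hom ≫ (braid X (tens Y Z) hX).hom ≫ (assoc Y Z X).hom =
      tensMap (braid X Y hX).hom (𝟙 Z) ≫ (assoc Y X Z).hom ≫ tensMap (𝟙 Y) (braid X Z hX).hom := by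
  apply tens_ext₃
  simp only [comp_hom, reassoc_of% proj_assoc, reassoc_of% proj_braid, proj_tensMap_assoc,
    BraidedCategory.braiding_naturality_right_assoc, proj_assoc, id_hom, tensorHom_id,
    ← comp_whiskerRight_assoc, proj_braid]
  simp only [comp_whiskerRight, Category.assoc, reassoc_of% proj_assoc, proj_tensMap, id_hom,
    id_tensorHom, ← MonoidalCategory.whiskerLeft_comp_assoc, proj_braid]
  simp

lemma hexagon₂ (X Y Z : RMod A) (hX : X.IsLocal) (hY : Y.IsLocal) (hXY : (tens X Y).IsLocal) :
    (assoc X Y Z).inv ≫ (braid (tens X Y) Z hXY).hom ≫ (assoc Z X Y).inv =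
      tensMap (𝟙 X) (braid Y Z hY).hom ≫ (assoc X Z Y).inv ≫ tensMap (braid X Z hX).hom (𝟙 Y) := by
  apply tens_ext₃'
  simp only [comp_hom, reassoc_of% proj_assoc_inv, reassoc_of% proj_braid, proj_tensMap_assoc,
    BraidedCategory.braiding_naturality_left_assoc, proj_assoc_inv, id_hom, id_tensorHom,
    ← MonoidalCategory.whiskerLeft_comp_assoc, proj_braid]
  simp only [MonoidalCategory.whiskerLeft_comp, Category.assoc, reassoc_of% proj_assoc_inv,
    proj_tensMap, id_hom,
    tensorHom_id, ← comp_whiskerRight_assoc, proj_braid]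
  simp

/-- The separability idempotent `p_{M,N}` on `M ⊗ N` attached to a bimodule section `s` of the
multiplication: it applies `s ∘ i` in the middle and lets the two copies of `A` act on `M` and,
through the half-braiding, on `N`. -/
def sepIdem (s : A ⟶ A ⊗ A) (M N : RMod A) : M.X ⊗ N.X ⟶ M.X ⊗ N.X :=
  M.X ◁ ((λ_ N.X).inv ≫ (η[A] ≫ s) ▷ N.X ≫ (α_ A A N.X).hom ≫ A ◁ N.lact) ≫
    (α_ M.X A N.X).inv ≫ M.act ▷ N.X

lemma sepIdem_proj {s : A ⟶ A ⊗ A} (hs : s ≫ μ[A] = 𝟙 A) (M N : RMod A) :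
    sepIdem s M N ≫ proj M N = proj M N := by
  have b := proj_balanced M N
  have h : (λ_ N.X).inv ≫ (η[A] ≫ s) ▷ N.X ≫ (α_ A A N.X).hom ≫ A ◁ N.lact ≫ N.lact = 𝟙 _ := by
    rw [← mul_lact, ← comp_whiskerRight_assoc, Category.assoc, hs, Category.comp_id, one_lact]
    simp
  unfold sepIdem
  rw [Category.assoc, Category.assoc, b, Iso.inv_hom_id_assoc,
    ← MonoidalCategory.whiskerLeft_comp_assoc]
  simp only [Category.assoc] at h ⊢
  rw [h]
  simp

lemma sepIdem_balanced {s : A ⟶ A ⊗ A} (hl : A ◁ s ≫ (α_ A A A).inv ≫ μ[A] ▷ A = μ[A] ≫ s)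
    (hr : s ▷ A ≫ (α_ A A A).hom ≫ A ◁ μ[A] = μ[A] ≫ s) (M N : RMod A) :
    M.act ▷ N.X ≫ sepIdem s M N = (α_ M.X A N.X).hom ≫ M.X ◁ N.lact ≫ sepIdem s M N := by
  have hl' : (ρ_ A).inv ≫ A ◁ (η[A] ≫ s) ≫ (α_ A A A).inv ≫ μ[A] ▷ A = s := by
    rw [MonoidalCategory.whiskerLeft_comp_assoc, hl]; simp
  have hr' : (λ_ A).inv ≫ (η[A] ≫ s) ▷ A ≫ (α_ A A A).hom ≫ A ◁ μ[A] = s := by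
    rw [comp_whiskerRight_assoc, hr]; simp
  set X := (λ_ N.X).inv ≫ (η[A] ≫ s) ▷ N.X ≫ (α_ A A N.X).hom ≫ A ◁ N.lact with hX
  have k₁ : A ◁ X ≫ (α_ A A N.X).inv ≫ μ[A] ▷ N.X = s ▷ N.X ≫ (α_ A A N.X).hom ≫ A ◁ N.lact := by
    calc
      _ = ((ρ_ A).inv ≫ A ◁ (η[A] ≫ s) ≫ (α_ A A A).inv ≫ μ[A] ▷ A) ▷ N.X ≫
          (α_ A A N.X).hom ≫ A ◁ N.lact := by
        have e : (A ◁ A ◁ N.lact) ≫ (α_ A A N.X).inv ≫ μ[A] ▷ N.X =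
            (α_ A A _).inv ≫ μ[A] ▷ (A ⊗ N.X) ≫ A ◁ N.lact := by
          rw [← whisker_exchange]; simp
        simp only [hX, MonoidalCategory.whiskerLeft_comp, Category.assoc, e]
        simp
      _ = _ := by rw [hl']
  have k₂ : N.lact ≫ X = s ▷ N.X ≫ (α_ A A N.X).hom ≫ A ◁ N.lact := by
    calc
      _ = (λ_ _).inv ≫ (η[A] ≫ s) ▷ (A ⊗ N.X) ≫ (α_ A A _).hom ≫ A ◁ (A ◁ N.lact ≫ N.lact) := by
        have e : N.lact ≫ (λ_ N.X).inv ≫ (η[A] ≫ s) ▷ N.X =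
            (λ_ _).inv ≫ (η[A] ≫ s) ▷ (A ⊗ N.X) ≫ (A ⊗ A) ◁ N.lact := by
          rw [← whisker_exchange]; simp
        rw [hX, reassoc_of% e]
        simp
      _ = ((λ_ A).inv ≫ (η[A] ≫ s) ▷ A ≫ (α_ A A A).hom ≫ A ◁ μ[A]) ▷ N.X ≫
          (α_ A A N.X).hom ≫ A ◁ N.lact := by
        have m : A ◁ N.lact ≫ N.lact = (α_ A A N.X).inv ≫ μ[A] ▷ N.X ≫ N.lact := by
          rw [mul_lact]; simp
        rw [m, whiskerRight_tensor]
        simp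
      _ = _ := by rw [hr']
  have k₃ : sepIdem s M N = M.X ◁ X ≫ (α_ M.X A N.X).inv ≫ M.act ▷ N.X := rfl
  calc
    _ = (M.X ⊗ A) ◁ X ≫ (α_ (M.X ⊗ A) A N.X).inv ≫ (M.act ▷ A ≫ M.act) ▷ N.X := by
      rw [k₃, ← whisker_exchange_assoc]; simp
    _ = (α_ M.X A N.X).hom ≫ M.X ◁ (A ◁ X ≫ (α_ A A N.X).inv ≫ μ[A] ▷ N.X) ≫
        (α_ M.X A N.X).inv ≫ M.act ▷ N.X := by rw [act_act]; simp
    _ = _ := by rw [k₁, ← k₂, k₃]; simp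

/-- The relative tensor product is the image of the separability idempotent. -/
lemma sepIdem_split {s : A ⟶ A ⊗ A} (hs : s ≫ μ[A] = 𝟙 A)
    (hl : A ◁ s ≫ (α_ A A A).inv ≫ μ[A] ▷ A = μ[A] ≫ s)
    (hr : s ▷ A ≫ (α_ A A A).hom ≫ A ◁ μ[A] = μ[A] ≫ s) (M N : RMod A) :
    ∃ i : (tens M N).X ⟶ M.X ⊗ N.X, proj M N ≫ i = sepIdem s M N ∧ i ≫ proj M N = 𝟙 _ := by
  refine ⟨desc _ (sepIdem_balanced hl hr M N), proj_desc _ _, ?_⟩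
  rw [← cancel_epi (proj M N), proj_desc_assoc, sepIdem_proj hs, Category.comp_id]


end Tensor
end Braided
end RMod

section Local

variable [BraidedCategory C]

/-- Local right modules as a property of right modules. -/
def isLocal (A : C) [MonObj A] : ObjectProperty (RMod A) := RMod.IsLocal

/-- The category `C_A^loc` of local right modules. -/
abbrev LocMod (A : C) [MonObj A] := (isLocal A).FullSubcategory

variable [HasCoequalizers C] [∀ Z : C, PreservesColimitsOfShape WalkingParallelPair (tensorLeft Z)]

instance (A : C) [MonObj A] [IsCommMonObj A] : (isLocal A).IsMonoidal where
  prop_unit := RMod.isLocal_regular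
  prop_tensor _ _ hM hN := RMod.isLocal_tens hM hN

noncomputable instance (A : C) [MonObj A] [IsCommMonObj A] : BraidedCategory (LocMod A) where
  braiding M N := (isLocal A).isoMk (RMod.braid M.obj N.obj M.property)
  braiding_naturality_right M N P f := by
    apply ObjectProperty.hom_ext
    exact RMod.braid_naturality M.property M.property (𝟙 M.obj) f.hom
  braiding_naturality_left {M N} f P := by
    apply ObjectProperty.hom_ext
    exact RMod.braid_naturality M.property N.property f.hom (𝟙 P.obj)
  hexagon_forward X Y Z := by
    apply ObjectProperty.hom_ext
    exact RMod.hexagon₁ X.obj Y.obj Z.obj X.property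
  hexagon_reverse X Y Z := by
    apply ObjectProperty.hom_ext
    exact RMod.hexagon₂ X.obj Y.obj Z.obj X.property Y.property
      (RMod.isLocal_tens X.property Y.property)

end Local
end Modules

section CategoricalGroups

/-- Strong monoidal functors, bundled with their monoidal structure. -/
structure StrongMonoidalFunctor (𝒢 : Type*) [Category* 𝒢] [MonoidalCategory 𝒢]
    (ℋ : Type*) [Category* ℋ] [MonoidalCategory ℋ] where
  toFunctor : 𝒢 ⥤ ℋ
  monoidal : toFunctor.Monoidal

namespace StrongMonoidalFunctor

attribute [instance] monoidal

variable {𝒢 : Type*} [Category* 𝒢] [MonoidalCategory 𝒢] {ℋ : Type*} [Category* ℋ]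
  [MonoidalCategory ℋ] {𝒦 : Type*} [Category* 𝒦] [MonoidalCategory 𝒦]

/-- Composition of strong monoidal functors. -/
def comp (F : StrongMonoidalFunctor 𝒢 ℋ) (H : StrongMonoidalFunctor ℋ 𝒦) :
    StrongMonoidalFunctor 𝒢 𝒦 where
  toFunctor := F.toFunctor ⋙ H.toFunctor
  monoidal := inferInstance

/-- The unit constraint `1 ⟶ F(1)`. -/
abbrev unit (F : StrongMonoidalFunctor 𝒢 ℋ) : 𝟙_ ℋ ⟶ F.toFunctor.obj (𝟙_ 𝒢) :=
  Functor.LaxMonoidal.ε F.toFunctor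

/-- The tensorator `F(X) ⊗ F(Y) ⟶ F(X ⊗ Y)`. -/
abbrev tensorator (F : StrongMonoidalFunctor 𝒢 ℋ) (X Y : 𝒢) :
    F.toFunctor.obj X ⊗ F.toFunctor.obj Y ⟶ F.toFunctor.obj (X ⊗ Y) :=
  Functor.LaxMonoidal.μ F.toFunctor X Y

end StrongMonoidalFunctor

/-- Linear braided autoequivalences of a linear braided monoidal category. -/
structure AutBr (D : Type u) [Category.{v} D] [Preadditive D] [Linear ℂ D] [MonoidalCategory D]
    [BraidedCategory D] where
  functor : D ⥤ D
  braided : functor.Braided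
  isEquivalence : functor.IsEquivalence
  additive : functor.Additive
  linear : functor.Linear ℂ

namespace AutBr

attribute [instance] braided isEquivalence additive linear

variable {D : Type u} [Category.{v} D] [Preadditive D] [Linear ℂ D] [MonoidalCategory D]
  [BraidedCategory D]

/-- Monoidal natural isomorphisms. -/
@[ext]
structure Hom (a b : AutBr D) where
  iso : a.functor ≅ b.functor
  isMonoidal : NatTrans.IsMonoidal iso.hom

attribute [instance] Hom.isMonoidal

instance : Category (AutBr D) where
  Hom a b := Hom a b
  id a := ⟨Iso.refl _, inferInstanceAs (NatTrans.IsMonoidal (𝟙 a.functor))⟩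
  comp f g := ⟨f.iso ≪≫ g.iso, inferInstanceAs (NatTrans.IsMonoidal (f.iso.hom ≫ g.iso.hom))⟩
  id_comp _ := Hom.ext (Iso.ext (Category.id_comp _))
  comp_id _ := Hom.ext (Iso.ext (Category.comp_id _))
  assoc _ _ _ := Hom.ext (Iso.ext (Category.assoc _ _ _))

/-- The component at an object of a monoidal natural isomorphism. -/
abbrev app {a b : AutBr D} (f : a ⟶ b) (X : D) : a.functor.obj X ⟶ b.functor.obj X :=
  (Hom.iso f).hom.app X

@[ext]
lemma hom_ext {a b : AutBr D} {f g : a ⟶ b} (h : ∀ X, app f X = app g X) : f = g :=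
  Hom.ext (Iso.ext (NatTrans.ext (funext h)))

@[simp] lemma id_app (a : AutBr D) (X : D) : app (𝟙 a) X = 𝟙 _ := rfl
@[simp] lemma comp_app {a b c : AutBr D} (f : a ⟶ b) (g : b ⟶ c) (X : D) :
    app (f ≫ g) X = app f X ≫ app g X := rfl

/-- Every 2-morphism is invertible. -/
instance : Groupoid (AutBr D) where
  inv f := ⟨(Hom.iso f).symm, inferInstanceAs (NatTrans.IsMonoidal (Hom.iso f).inv)⟩
  inv_comp f := hom_ext fun X => (Hom.iso f).inv_hom_id_app X
  comp_inv f := hom_ext fun X => (Hom.iso f).hom_inv_id_app X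

/-- The composite `a ∘ b`. -/
abbrev comp (a b : AutBr D) : AutBr D where
  functor := b.functor ⋙ a.functor
  braided := inferInstance
  isEquivalence := inferInstance
  additive := inferInstance
  linear := inferInstance

variable (D) in
/-- The identity autoequivalence. -/
abbrev one : AutBr D where
  functor := 𝟭 D
  braided := inferInstance
  isEquivalence := inferInstance
  additive := inferInstance
  linear := inferInstance

/-- An isomorphism in `AutBr D` from a monoidal natural isomorphism. -/
def isoMk {a b : AutBr D} (e : a.functor ≅ b.functor) (h : NatTrans.IsMonoidal e.hom) : a ≅ b where
  hom := ⟨e, h⟩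
  inv := ⟨e.symm, inferInstanceAs (NatTrans.IsMonoidal e.inv)⟩
  hom_inv_id := hom_ext fun X => e.hom_inv_id_app X
  inv_hom_id := hom_ext fun X => e.inv_hom_id_app X

instance : MonoidalCategoryStruct (AutBr D) where
  tensorObj a b := comp a b
  tensorUnit := one D
  whiskerLeft a _ _ f := ⟨Functor.isoWhiskerRight (Hom.iso f) a.functor,
    inferInstanceAs (NatTrans.IsMonoidal (Functor.whiskerRight (Hom.iso f).hom a.functor))⟩
  whiskerRight f a := ⟨Functor.isoWhiskerLeft a.functor (Hom.iso f),
    inferInstanceAs (NatTrans.IsMonoidal (Functor.whiskerLeft a.functor (Hom.iso f).hom))⟩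
  associator a b c := (isoMk (a := comp a (comp b c)) (b := comp (comp a b) c)
    (Functor.associator c.functor b.functor a.functor) inferInstance).symm
  leftUnitor a := isoMk (a := comp (one D) a) a.functor.rightUnitor inferInstance
  rightUnitor a := isoMk (a := comp a (one D)) a.functor.leftUnitor inferInstance

@[simp] lemma whiskerLeft_app (a : AutBr D) {b c : AutBr D} (f : b ⟶ c) (X : D) :
    app (a ◁ f) X = a.functor.map (app f X) := rfl
@[simp] lemma whiskerRight_app {b c : AutBr D} (f : b ⟶ c) (a : AutBr D) (X : D) :
    app (f ▷ a) X = app f (a.functor.obj X) := rfl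
@[simp] lemma associator_hom_app (a b c : AutBr D) (X : D) :
    app (α_ a b c).hom X = 𝟙 (a.functor.obj (b.functor.obj (c.functor.obj X))) := rfl
@[simp] lemma leftUnitor_hom_app (a : AutBr D) (X : D) :
    app (λ_ a).hom X = 𝟙 (a.functor.obj X) := rfl
@[simp] lemma rightUnitor_hom_app (a : AutBr D) (X : D) :
    app (ρ_ a).hom X = 𝟙 (a.functor.obj X) := rfl

@[simp] lemma tensorHom_app {a b c d : AutBr D} (f : a ⟶ b) (g : c ⟶ d) (X : D) :
    app (f ⊗ₘ g) X = app f (c.functor.obj X) ≫ b.functor.map (app g X) := rfl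

lemma app_naturality {a b : AutBr D} (f : a ⟶ b) {X Y : D} (k : X ⟶ Y) :
    a.functor.map k ≫ app f Y = app f X ≫ b.functor.map k := (Hom.iso f).hom.naturality k

lemma functor_tensor (a b : AutBr D) : (a ⊗ b).functor = b.functor ⋙ a.functor := rfl

lemma functor_unit : (𝟙_ (AutBr D)).functor = 𝟭 D := rfl

/-- The categorical group of braided autoequivalences, with tensor product the composition. -/
instance : MonoidalCategory (AutBr D) where
  tensorHom_def _ _ := rfl
  id_tensorHom_id a b := by
    ext X
    change 𝟙 _ ≫ a.functor.map (𝟙 _) = 𝟙 _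
    simp
  tensorHom_comp_tensorHom {a₁ b₁ c₁ a₂ b₂ c₂} f₁ f₂ g₁ g₂ := by
    ext X
    change (app f₁ _ ≫ b₁.functor.map (app f₂ X)) ≫ app g₁ _ ≫ c₁.functor.map (app g₂ X) =
      (app f₁ _ ≫ app g₁ _) ≫ c₁.functor.map (app f₂ X ≫ app g₂ X)
    simp
  whiskerLeft_id a b := by
    ext X
    exact a.functor.map_id _
  id_whiskerRight a b := rfl
  associator_naturality {a₁ a₂ a₃ b₁ b₂ b₃} f g h := by
    ext X
    change ((app f _ ≫ b₁.functor.map (app g _)) ≫ b₁.functor.map (b₂.functor.map (app h X))) ≫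
      𝟙 _ = 𝟙 _ ≫ app f _ ≫ b₁.functor.map (app g _ ≫ b₂.functor.map (app h X))
    simp
  leftUnitor_naturality f := by
    ext X
    change app f X ≫ 𝟙 _ = 𝟙 _ ≫ app f X
    simp
  rightUnitor_naturality {a b} f := by
    ext X
    change app f X ≫ 𝟙 _ = 𝟙 _ ≫ app f X
    simp
  pentagon a b c d := by
    ext X
    change 𝟙 _ ≫ 𝟙 _ ≫ a.functor.map (𝟙 _) = 𝟙 _ ≫ 𝟙 _
    simp
  triangle a b := by
    ext X
    change 𝟙 _ ≫ a.functor.map (𝟙 _) = 𝟙 _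
    simp

end AutBr

section Pairs

variable {C : Type u} [Category.{v} C] [Preadditive C] [Linear ℂ C] [MonoidalCategory C]
  [BraidedCategory C]

open scoped Obj

/-- An algebra isomorphism `a(A) ≅ A`, where `a(A)` has the multiplication `a(m) ∘ ψ_{A,A}` and
the unit `a(i)` (precomposed with the unit constraint of `a`). -/
structure AlgIso (a : AutBr C) (A : C) [MonObj A] where
  iso : a.functor.obj A ≅ A
  isMonHom : IsMonHom iso.hom

/-- The full categorical subgroup of autoequivalences `a` such that `a(A) ≅ A` as algebras. -/
def Stab (A : C) [MonObj A] : ObjectProperty (AutBr C) := fun a => Nonempty (AlgIso a A)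

/-- Pairs of a braided autoequivalence `a` and an algebra isomorphism `a(A) ≅ A`. -/
structure AutPair (A : C) [MonObj A] where
  aut : AutBr C
  lam : AlgIso aut A

namespace AutPair

variable {A : C} [MonObj A]

/-- Monoidal natural isomorphisms compatible with the chosen algebra isomorphisms. -/
@[ext]
structure Hom (a b : AutPair A) where
  hom : a.aut ⟶ b.aut
  comm : AutBr.app hom A ≫ b.lam.iso.hom = a.lam.iso.hom

instance : Category (AutPair A) where
  Hom a b := Hom a b
  id a := ⟨𝟙 a.aut, Category.id_comp _⟩
  comp f g := ⟨f.hom ≫ g.hom, by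
    rw [AutBr.comp_app, Category.assoc, g.comm, f.comm]⟩
  id_comp _ := Hom.ext (Category.id_comp _)
  comp_id _ := Hom.ext (Category.comp_id _)
  assoc _ _ _ := Hom.ext (Category.assoc _ _ _)

@[ext]
lemma hom_ext {a b : AutPair A} {f g : a ⟶ b} (h : f.hom = g.hom) : f = g := Hom.ext h

/-- An isomorphism of pairs from a compatible isomorphism of autoequivalences. -/
def isoMk {a b : AutPair A} (e : a.aut ≅ b.aut)
    (h : AutBr.app e.hom A ≫ b.lam.iso.hom = a.lam.iso.hom) : a ≅ b where
  hom := ⟨e.hom, h⟩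
  inv := ⟨e.inv, by
    rw [← h, ← Category.assoc, ← AutBr.comp_app, e.inv_hom_id, AutBr.id_app, Category.id_comp]⟩
  hom_inv_id := Hom.ext e.hom_inv_id
  inv_hom_id := Hom.ext e.inv_hom_id

lemma isMonHom_one : @IsMonHom C _ _ ((𝟙_ (AutBr C)).functor.obj A) A
    ((𝟭 C).monObjObj A) _ (𝟙 A) where
  one_hom := by
    change (𝟙 _ ≫ η[A]) ≫ 𝟙 A = η[A]
    simp
  mul_hom := by
    change (𝟙 _ ≫ μ[A]) ≫ 𝟙 A = (𝟙 A ⊗ₘ 𝟙 A) ≫ μ[A]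
    simp

lemma isMonHom_comp (a b : AutPair A) :
    @IsMonHom C _ _ ((a.aut ⊗ b.aut).functor.obj A) A
      ((b.aut.functor ⋙ a.aut.functor).monObjObj A) _
      (a.aut.functor.map b.lam.iso.hom ≫ a.lam.iso.hom) := by
  have hb := b.lam.isMonHom
  have ha := a.lam.isMonHom
  have hb1 : (Functor.LaxMonoidal.ε b.aut.functor ≫ b.aut.functor.map η[A]) ≫ b.lam.iso.hom =
    η[A] := hb.one_hom
  have ha1 : (Functor.LaxMonoidal.ε a.aut.functor ≫ a.aut.functor.map η[A]) ≫ a.lam.iso.hom =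
    η[A] := ha.one_hom
  have hb2 : (Functor.LaxMonoidal.μ b.aut.functor A A ≫ b.aut.functor.map μ[A]) ≫ b.lam.iso.hom =
    (b.lam.iso.hom ⊗ₘ b.lam.iso.hom) ≫ μ[A] := hb.mul_hom
  have ha2 : (Functor.LaxMonoidal.μ a.aut.functor A A ≫ a.aut.functor.map μ[A]) ≫ a.lam.iso.hom =
    (a.lam.iso.hom ⊗ₘ a.lam.iso.hom) ≫ μ[A] := ha.mul_hom
  refine @IsMonHom.mk _ _ _ _ _ _ _ _ ?_ ?_
  · change (((Functor.LaxMonoidal.ε a.aut.functor ≫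
      a.aut.functor.map (Functor.LaxMonoidal.ε b.aut.functor)) ≫
      a.aut.functor.map (b.aut.functor.map η[A])) ≫ a.aut.functor.map b.lam.iso.hom ≫
        a.lam.iso.hom) = η[A]
    simp only [Category.assoc, ← Functor.map_comp_assoc] at *
    rw [hb1, ha1]
  · change (((Functor.LaxMonoidal.μ a.aut.functor _ _ ≫
      a.aut.functor.map (Functor.LaxMonoidal.μ b.aut.functor A A)) ≫
      a.aut.functor.map (b.aut.functor.map μ[A])) ≫ a.aut.functor.map b.lam.iso.hom ≫
        a.lam.iso.hom) = ((a.aut.functor.map b.lam.iso.hom ≫ a.lam.iso.hom) ⊗ₘ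
          (a.aut.functor.map b.lam.iso.hom ≫ a.lam.iso.hom)) ≫ μ[A]
    simp only [Category.assoc, ← Functor.map_comp_assoc] at *
    rw [hb2, ← tensorHom_comp_tensorHom, Category.assoc, ← ha2]
    simp

variable (A) in
/-- The identity functor with the identity of `A`. -/
abbrev one : AutPair A where
  aut := 𝟙_ (AutBr C)
  lam := ⟨Iso.refl A, isMonHom_one⟩

/-- The composite `(a, λ) ∘ (b, κ) = (a ∘ b, λ ∘ a(κ))`. -/
abbrev comp (a b : AutPair A) : AutPair A where
  aut := a.aut ⊗ b.aut
  lam := ⟨a.aut.functor.mapIso b.lam.iso ≪≫ a.lam.iso, isMonHom_comp a b⟩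

instance : MonoidalCategoryStruct (AutPair A) where
  tensorObj a b := comp a b
  tensorUnit := one A
  whiskerLeft a b c f := ⟨a.aut ◁ f.hom, by
    change a.aut.functor.map _ ≫ a.aut.functor.map _ ≫ _ = a.aut.functor.map _ ≫ _
    rw [← Functor.map_comp_assoc, f.comm]⟩
  whiskerRight {a b} f c := ⟨f.hom ▷ c.aut, by
    change AutBr.app f.hom _ ≫ b.aut.functor.map _ ≫ _ = a.aut.functor.map _ ≫ _
    rw [← f.comm, reassoc_of% (AutBr.app_naturality f.hom c.lam.iso.hom)]⟩
  associator a b c := isoMk (α_ a.aut b.aut c.aut) (by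
    change 𝟙 _ ≫ a.aut.functor.map (b.aut.functor.map _ ≫ _) ≫ _ =
      a.aut.functor.map (b.aut.functor.map _) ≫ a.aut.functor.map _ ≫ _
    simp)
  leftUnitor a := isoMk (λ_ a.aut) (by
    change 𝟙 _ ≫ a.lam.iso.hom = a.lam.iso.hom ≫ 𝟙 _
    simp)
  rightUnitor a := isoMk (ρ_ a.aut) (by
    change 𝟙 _ ≫ _ = a.aut.functor.map (𝟙 _) ≫ _
    simp)

/-- The categorical group of pairs. -/
instance : MonoidalCategory (AutPair A) where
  tensorHom_def _ _ := rfl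
  id_tensorHom_id a b := Hom.ext (id_tensorHom_id a.aut b.aut)
  tensorHom_comp_tensorHom f g h k := Hom.ext (tensorHom_comp_tensorHom f.hom g.hom h.hom k.hom)
  whiskerLeft_id a b := Hom.ext (MonoidalCategory.whiskerLeft_id a.aut b.aut)
  id_whiskerRight a b := Hom.ext (MonoidalCategory.id_whiskerRight a.aut b.aut)
  associator_naturality f g h := Hom.ext (associator_naturality f.hom g.hom h.hom)
  leftUnitor_naturality f := Hom.ext (leftUnitor_naturality f.hom)
  rightUnitor_naturality f := Hom.ext (rightUnitor_naturality f.hom)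
  pentagon a b c d := Hom.ext (pentagon a.aut b.aut c.aut d.aut)
  triangle a b := Hom.ext (triangle a.aut b.aut)

variable (A) in
/-- The forgetful functor `(a, λ) ↦ a`. -/
def forgetFunctor : AutPair A ⥤ AutBr C where
  obj a := a.aut
  map f := f.hom

instance : (forgetFunctor A).Monoidal :=
  Functor.CoreMonoidal.toMonoidal
    { εIso := Iso.refl (𝟙_ (AutBr C))
      μIso := fun a b => Iso.refl (a.aut ⊗ b.aut)
      μIso_hom_natural_left := fun f c => by
        change f.hom ▷ c.aut ≫ 𝟙 _ = 𝟙 _ ≫ f.hom ▷ c.aut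
        simp
      μIso_hom_natural_right := fun c f => by
        change c.aut ◁ f.hom ≫ 𝟙 _ = 𝟙 _ ≫ c.aut ◁ f.hom
        simp
      associativity := fun a b c => by
        change 𝟙 (a.aut ⊗ b.aut) ▷ c.aut ≫ 𝟙 _ ≫ (α_ a.aut b.aut c.aut).hom =
          (α_ a.aut b.aut c.aut).hom ≫ a.aut ◁ 𝟙 (b.aut ⊗ c.aut) ≫ 𝟙 _
        simp
      left_unitality := fun a => by
        change (λ_ a.aut).hom = 𝟙 (𝟙_ (AutBr C)) ▷ a.aut ≫ 𝟙 _ ≫ (λ_ a.aut).hom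
        simp
      right_unitality := fun a => by
        change (ρ_ a.aut).hom = a.aut ◁ 𝟙 (𝟙_ (AutBr C)) ≫ 𝟙 _ ≫ (ρ_ a.aut).hom
        simp }

variable (A) in
/-- The forgetful functor, as a strong (in fact strict) monoidal functor. -/
def forget : StrongMonoidalFunctor (AutPair A) (AutBr C) := ⟨forgetFunctor A, inferInstance⟩

end AutPair

/-- A categorical action of `G` by braided autoequivalences: a strong monoidal functor from `G`,
seen as a discrete monoidal category. -/
abbrev CatAction (G : Type w) [Group G] (C : Type u) [Category.{v} C] [Preadditive C] [Linear ℂ C]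
    [MonoidalCategory C] [BraidedCategory C] :=
  StrongMonoidalFunctor (Discrete G) (AutBr C)

namespace CatAction

variable {G : Type w} [Group G]

/-- The autoequivalence by which `g` acts. -/
abbrev aut (ρ : CatAction G C) (g : G) : AutBr C := ρ.toFunctor.obj (Discrete.mk g)

/-- The tensorator `μ_{g,h} : g(h(X)) ⟶ (gh)(X)`. -/
abbrev mu (ρ : CatAction G C) (g h : G) (X : C) :
    (ρ.aut g).functor.obj ((ρ.aut h).functor.obj X) ⟶ (ρ.aut (g * h)).functor.obj X :=
  AutBr.app (ρ.tensorator (Discrete.mk g) (Discrete.mk h)) X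

/-- The unit constraint `X ⟶ e(X)`. -/
abbrev eps (ρ : CatAction G C) (X : C) : X ⟶ (ρ.aut 1).functor.obj X :=
  AutBr.app ρ.unit X

/-- Lifts of a categorical action along the forgetful functor `(a, λ) ↦ a`. -/
structure Lift (ρ : CatAction G C) (A : C) [MonObj A] where
  lift : StrongMonoidalFunctor (Discrete G) (AutPair A)
  comp_forget : lift.comp (AutPair.forget A) = ρ

/-- `G`-equivariant algebra structures on `A`: algebra isomorphisms `λ^g : g(A) ⟶ A` such that
`λ^g ∘ g(λ^h) = λ^{gh} ∘ μ_{g,h}`. -/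
structure EquivariantAlgebra (ρ : CatAction G C) (A : C) [MonObj A] where
  lam : ∀ g : G, AlgIso (ρ.aut g) A
  equivariant : ∀ g h : G, (ρ.aut g).functor.map (lam h).iso.hom ≫ (lam g).iso.hom =
    ρ.mu g h A ≫ (lam (g * h)).iso.hom

end CatAction

/-- Twisting right modules by a pair `(a, λ)`: the module `(M, r)` is sent to `a(M)` with the action
`a(r) ∘ ψ_{M,A} ∘ (id ⊗ λ⁻¹)`. -/
def twist {A : C} [MonObj A] (p : AutPair A) : RMod A ⥤ RMod A where
  obj M :=
    { X := p.aut.functor.obj M.X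
      act := p.aut.functor.obj M.X ◁ p.lam.iso.inv ≫ Functor.LaxMonoidal.μ p.aut.functor M.X A ≫
        p.aut.functor.map M.act
      act_one := by
        have h := p.lam.isMonHom.one_hom
        have h' : η[A] ≫ p.lam.iso.inv = Functor.LaxMonoidal.ε p.aut.functor ≫
          p.aut.functor.map η[A] := by rw [Iso.comp_inv_eq]; exact h.symm
        rw [← MonoidalCategory.whiskerLeft_comp_assoc, h']
        simp [← Functor.map_comp, M.act_one]
      act_mul := by
        have h := p.lam.isMonHom.mul_hom
        have h' : μ[A] ≫ p.lam.iso.inv = (p.lam.iso.inv ⊗ₘ p.lam.iso.inv) ≫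
            Functor.LaxMonoidal.μ p.aut.functor A A ≫ p.aut.functor.map μ[A] := by
          rw [Iso.comp_inv_eq]
          have h2 : (Functor.LaxMonoidal.μ p.aut.functor A A ≫ p.aut.functor.map μ[A]) ≫
            p.lam.iso.hom = (p.lam.iso.hom ⊗ₘ p.lam.iso.hom) ≫ μ[A] := h
          rw [Category.assoc, h2, tensorHom_comp_tensorHom_assoc]
          simp
        rw [← MonoidalCategory.whiskerLeft_comp_assoc, h']
        simp only [MonoidalCategory.whiskerLeft_comp, Category.assoc,
          Functor.LaxMonoidal.μ_natural_right_assoc, ← Functor.map_comp, M.act_mul]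
        simp only [Functor.map_comp, Functor.LaxMonoidal.associativity_inv_assoc,
          comp_whiskerRight, Category.assoc, ← Functor.LaxMonoidal.μ_natural_left_assoc]
        rw [← whisker_exchange_assoc, ← whisker_exchange_assoc, MonoidalCategory.tensorHom_def]
        simp }
  map f :=
    { hom := p.aut.functor.map f.hom
      comm := by
        simp only [Category.assoc, ← Functor.map_comp, f.comm]
        rw [← whisker_exchange_assoc, Functor.LaxMonoidal.μ_natural_left_assoc, Functor.map_comp] }
  map_id M := by ext; simp
  map_comp f g := by ext; simp

end Pairs

end CategoricalGroups

section Fusion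

attribute [local instance] Abelian.hasFiniteBiproducts

variable (C : Type u) [Category.{v} C] [MonoidalCategory C]

/-- In a rigid category the tensor product preserves coequalizers. -/
instance preservesCoequalizers_tensorLeft [RigidCategory C] (Z : C) :
    PreservesColimitsOfShape WalkingParallelPair (tensorLeft Z) :=
  (tensorLeftAdjunction (ᘁZ) Z).leftAdjoint_preservesColimits.preservesColimitsOfShape

/-- A rigid linear abelian monoidal category is a fusion category if it is semisimple with
finite-dimensional morphism spaces, finitely many simple objects up to isomorphism, and a simple
tensor unit. -/
structure IsFusion [Abelian C] [Linear ℂ C] [RigidCategory C] : Prop where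
  finite_hom : ∀ X Y : C, Module.Finite ℂ (X ⟶ Y)
  semisimple : ∀ X : C, ∃ (n : ℕ) (S : Fin n → C), (∀ i, Simple (S i)) ∧ Nonempty (X ≅ ⨁ S)
  finite_simple : ∃ (n : ℕ) (S : Fin n → C), ∀ X : C, Simple X → ∃ i, Nonempty (X ≅ S i)
  simple_unit : Simple (𝟙_ C)

/-- The braiding is non-degenerate: every object that is transparent (has trivial double braiding
with all objects) is a direct sum of copies of the tensor unit. -/
def IsNondegenerate [Abelian C] [BraidedCategory C] : Prop :=
  ∀ X : C, (∀ Y : C, (β_ X Y).hom ≫ (β_ Y X).hom = 𝟙 (X ⊗ Y)) →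
    ∃ n : ℕ, Nonempty (X ≅ ⨁ fun _ : Fin n => 𝟙_ C)

variable {C}

/-- An algebra is separable if its multiplication has a section which is a map of bimodules. -/
def IsSeparableAlgebra (A : C) [MonObj A] : Prop :=
  ∃ s : A ⟶ A ⊗ A, s ≫ μ[A] = 𝟙 A ∧
    A ◁ s ≫ (α_ A A A).inv ≫ μ[A] ▷ A = μ[A] ≫ s ∧
    s ▷ A ≫ (α_ A A A).hom ≫ A ◁ μ[A] = μ[A] ≫ s

/-- An algebra is connected if `Hom(1, A)` is one-dimensional. -/
def IsConnectedAlgebra [Preadditive C] [Linear ℂ C] (A : C) : Prop :=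
  Module.finrank ℂ (𝟙_ C ⟶ A) = 1

end Fusion

section Induced

variable {C : Type u} [Category.{v} C] [Preadditive C] [Linear ℂ C] [MonoidalCategory C]
  [MonoidalPreadditive C] [MonoidalLinear ℂ C] [BraidedCategory C] [HasCoequalizers C]
  [∀ Z : C, PreservesColimitsOfShape WalkingParallelPair (tensorLeft Z)]
  {A : C} [MonObj A] [IsCommMonObj A]

/-- A braided autoequivalence `b` of `C_A^loc` is given by twisting with the pair `p = (a, λ)`: its
underlying functor is identified with the twisting functor, its tensorator is induced by the
tensorator of `a` through the projections `M ⊗ N ⟶ M ⊗_A N`, and its unit constraint is `λ⁻¹`. -/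
structure TwistIso (p : AutPair A) (b : AutBr (LocMod A)) where
  iso : b.functor ⋙ (isLocal A).ι ≅ (isLocal A).ι ⋙ twist p
  tensor : ∀ M N : LocMod A,
    RMod.proj (b.functor.obj M).obj (b.functor.obj N).obj ≫
        (Functor.LaxMonoidal.μ b.functor M N).hom.hom ≫ (iso.hom.app (M ⊗ N)).hom =
      ((iso.hom.app M).hom ⊗ₘ (iso.hom.app N).hom) ≫
        Functor.LaxMonoidal.μ p.aut.functor M.obj.X N.obj.X ≫
          p.aut.functor.map (RMod.proj M.obj N.obj)
  unit : (Functor.LaxMonoidal.ε b.functor).hom.hom ≫ (iso.hom.app (𝟙_ (LocMod A))).hom =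
    p.lam.iso.inv

/-- The underlying isomorphism in `C` from `b(M)` to `a(M)`. -/
abbrev TwistIso.app {p : AutPair A} {b : AutBr (LocMod A)} (t : TwistIso p b) (M : LocMod A) :
    (b.functor.obj M).obj.X ⟶ p.aut.functor.obj M.obj.X :=
  (t.iso.hom.app M).hom

/-- A strong monoidal functor from pairs to braided autoequivalences of `C_A^loc` is the canonical
one: it sends a pair to the twist by this pair, a morphism `f` of pairs to the natural isomorphism
with components `f_M`, and its own monoidal constraints are the identities of
`a(b(M)) = (a ∘ b)(M)` and of `M`. -/
structure TwistFunctorData (F : StrongMonoidalFunctor (AutPair A) (AutBr (LocMod A))) where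
  tw : ∀ p : AutPair A, TwistIso p (F.toFunctor.obj p)
  map : ∀ {p q : AutPair A} (f : p ⟶ q) (M : LocMod A),
    (AutBr.app (F.toFunctor.map f) M).hom.hom ≫ (tw q).app M =
      (tw p).app M ≫ AutBr.app f.hom M.obj.X
  tensor : ∀ (p q : AutPair A) (M : LocMod A),
    (AutBr.app (F.tensorator p q) M).hom.hom ≫ (tw (p ⊗ q)).app M =
      (tw p).app ((F.toFunctor.obj q).functor.obj M) ≫ p.aut.functor.map ((tw q).app M)
  unit : ∀ M : LocMod A,
    (AutBr.app F.unit M).hom.hom ≫ (tw (𝟙_ (AutPair A))).app M = 𝟙 M.obj.X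

/-- A categorical action on `C_A^loc` is the one induced by the action `ρ` on `C` and the
equivariant algebra structure `l`: the element `g` acts by twisting with `(g, λ^g)`, and the
monoidal constraints are those of `ρ`. -/
structure InducedActionData {G : Type w} [Group G] (ρ : CatAction G C) (l : ρ.EquivariantAlgebra A)
    (σ : CatAction G (LocMod A)) where
  tw : ∀ g : G, TwistIso ⟨ρ.aut g, l.lam g⟩ (σ.aut g)
  tensor : ∀ (g h : G) (M : LocMod A),
    (σ.mu g h M).hom.hom ≫ (tw (g * h)).app M =
      (tw g).app ((σ.aut h).functor.obj M) ≫ (ρ.aut g).functor.map ((tw h).app M) ≫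
        ρ.mu g h M.obj.X
  unit : ∀ M : LocMod A, (σ.eps M).hom.hom ≫ (tw 1).app M = ρ.eps M.obj.X

end Induced

end Condensation

open Condensation

/-! Let `F` be a braided functor and `φ : B ≅ F(A)` an isomorphism of commutative algebras. If `F`
is fully faithful, then `r ↦ (id ⊗ φ) ≫ μ ≫ F(r)` is a bijection from maps `X ⊗ A ⟶ Y` to maps
`F(X) ⊗ B ⟶ F(Y)`, and it matches the module axioms and locality on the two sides. Hence an
equivalence `F` induces an equivalence of the categories of local modules. The tensorator of `F`
descends to `F(M) ⊗_B F(N) ≅ F(M ⊗_A N)` because `F` preserves the defining coequalizer, and every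
coherence condition can be checked after precomposing with the projections from `M ⊗ N`, where it
is the corresponding condition for `F`. Twisting by `(α, λ)` is the case `F = α`, `φ = λ⁻¹`.

A lift of an action `ρ` is determined by its family `λ`, since its monoidal constraints are those of
`ρ`. Compatibility of `λ` with the tensor constraint of `ρ` is equivariance, and compatibility with
the unit constraint follows from equivariance at `(1, 1)`.
-/

namespace Condensation

open Functor Functor.LaxMonoidal
open scoped Obj

section TransportAct

variable {C : Type*} [Category* C] [MonoidalCategory C] {D : Type*} [Category* D]
  [MonoidalCategory D] (F : C ⥤ D) {A X Y Z : C} {B : D} (φ : B ⟶ F.obj A)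

/-- The image of an action map `X ⊗ A ⟶ Y` under a lax monoidal functor `F`, restricted along
`φ : B ⟶ F(A)`. The target `Y` is arbitrary, so that both sides of each module axiom are
instances of the construction. -/
def transportAct [F.LaxMonoidal] (r : X ⊗ A ⟶ Y) : F.obj X ⊗ B ⟶ F.obj Y :=
  F.obj X ◁ φ ≫ LaxMonoidal.μ F X A ≫ F.map r

section Lax

variable [F.LaxMonoidal]

lemma transportAct_comp_map (r : X ⊗ A ⟶ Y) (f : Y ⟶ Z) :
    transportAct F φ r ≫ F.map f = transportAct F φ (r ≫ f) := by
  simp [transportAct]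

lemma map_whiskerRight_comp_transportAct (f : X ⟶ Y) (r : Y ⊗ A ⟶ Z) :
    F.map f ▷ B ≫ transportAct F φ r = transportAct F φ (f ▷ A ≫ r) := by
  rw [transportAct, transportAct, ← whisker_exchange_assoc, μ_natural_left_assoc, map_comp]

lemma transportAct_comp {E : Type*} [Category* E] [MonoidalCategory E] (H : D ⥤ E)
    [H.LaxMonoidal] {B' : E} (κ : B' ⟶ H.obj B) (r : X ⊗ A ⟶ Y) :
    transportAct H κ (transportAct F φ r) =
      transportAct (F ⋙ H) (A := A) (κ ≫ H.map φ) (X := X) r := by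
  simp [transportAct]

lemma transportAct_id (r : X ⊗ A ⟶ Y) : transportAct (𝟭 C) (𝟙 A) r = r := by
  simp [transportAct]

lemma whiskerRight_app_comp_transportAct {F' : C ⥤ D} [F'.LaxMonoidal] (θ : F ⟶ F')
    [NatTrans.IsMonoidal θ] (r : X ⊗ A ⟶ Y) :
    θ.app X ▷ B ≫ transportAct F' (φ ≫ θ.app A) r = transportAct F φ r ≫ θ.app Y := by
  simp only [transportAct, Category.assoc, NatTrans.naturality, NatTrans.IsMonoidal.tensor_assoc,
    MonoidalCategory.tensorHom_def', MonoidalCategory.whiskerLeft_comp, whisker_exchange_assoc]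

lemma transportAct_whiskerRight_comp_transportAct (r : X ⊗ A ⟶ Y) (s : Y ⊗ A ⟶ Z) :
    (α_ _ _ _).inv ≫ transportAct F φ r ▷ B ≫ transportAct F φ s =
      F.obj X ◁ (φ ⊗ₘ φ) ≫ F.obj X ◁ LaxMonoidal.μ F A A ≫ LaxMonoidal.μ F X (A ⊗ A) ≫
        F.map ((α_ X A A).inv ≫ r ▷ A ≫ s) := by
  simp only [transportAct, Functor.map_comp, Functor.LaxMonoidal.associativity_inv_assoc,
    comp_whiskerRight, Category.assoc, ← Functor.LaxMonoidal.μ_natural_left_assoc]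
  rw [← whisker_exchange_assoc, ← whisker_exchange_assoc, MonoidalCategory.tensorHom_def]
  simp

variable [MonObj A] [MonObj B] [IsMonHom φ]

lemma whiskerLeft_one_comp_transportAct (r : X ⊗ A ⟶ Y) :
    F.obj X ◁ η[B] ≫ transportAct F φ r =
      F.obj X ◁ ε F ≫ LaxMonoidal.μ F X (𝟙_ C) ≫ F.map (X ◁ η[A] ≫ r) := by
  rw [transportAct, ← MonoidalCategory.whiskerLeft_comp_assoc, IsMonHom.one_hom, obj.η_def]
  simp

lemma whiskerLeft_mul_comp_transportAct (r : X ⊗ A ⟶ Y) :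
    F.obj X ◁ μ[B] ≫ transportAct F φ r =
      F.obj X ◁ (φ ⊗ₘ φ) ≫ F.obj X ◁ LaxMonoidal.μ F A A ≫ LaxMonoidal.μ F X (A ⊗ A) ≫
        F.map (X ◁ μ[A] ≫ r) := by
  rw [transportAct, ← MonoidalCategory.whiskerLeft_comp_assoc, IsMonHom.mul_hom, obj.μ_def]
  simp

end Lax

section Strong

variable [F.Monoidal]

lemma whiskerLeft_one_comp_transportAct_eq_iff [F.Faithful] [MonObj A] [MonObj B] [IsMonHom φ]
    (r : X ⊗ A ⟶ X) :
    F.obj X ◁ η[B] ≫ transportAct F φ r = (ρ_ (F.obj X)).hom ↔ X ◁ η[A] ≫ r = (ρ_ X).hom := by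
  rw [whiskerLeft_one_comp_transportAct, LaxMonoidal.right_unitality F X, cancel_epi, cancel_epi,
    F.map_injective.eq_iff]

variable [IsIso φ]

lemma whiskerLeft_mul_comp_transportAct_eq_iff [F.Faithful] [MonObj A] [MonObj B] [IsMonHom φ]
    (r : X ⊗ A ⟶ X) :
    F.obj X ◁ μ[B] ≫ transportAct F φ r =
        (α_ _ _ _).inv ≫ transportAct F φ r ▷ B ≫ transportAct F φ r ↔
      X ◁ μ[A] ≫ r = (α_ X A A).inv ≫ r ▷ A ≫ r := by
  rw [whiskerLeft_mul_comp_transportAct, transportAct_whiskerRight_comp_transportAct, cancel_epi,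
    cancel_epi, cancel_epi, F.map_injective.eq_iff]

lemma transportAct_injective [F.Faithful] :
    Function.Injective (transportAct F φ : (X ⊗ A ⟶ Y) → _) := fun _ _ h =>
  F.map_injective ((cancel_epi _).1 ((cancel_epi _).1 h))

lemma transportAct_surjective [F.Full] :
    Function.Surjective (transportAct F φ : (X ⊗ A ⟶ Y) → _) := fun s => by
  obtain ⟨r, hr⟩ := F.map_surjective (inv (F.obj X ◁ φ ≫ LaxMonoidal.μ F X A) ≫ s)
  exact ⟨r, by simp [transportAct, hr]⟩

end Strong

section Braided

variable [BraidedCategory C] [BraidedCategory D] [F.LaxBraided]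

lemma braiding_comp_transportAct (r : X ⊗ A ⟶ Y) :
    (β_ B (F.obj X)).hom ≫ transportAct F φ r =
      φ ▷ F.obj X ≫ LaxMonoidal.μ F A X ≫ F.map ((β_ A X).hom ≫ r) := by
  rw [transportAct, map_comp, LaxBraided.braided_assoc]
  simp

lemma braiding_braiding_comp_transportAct (r : X ⊗ A ⟶ Y) :
    (β_ (F.obj X) B).hom ≫ (β_ B (F.obj X)).hom ≫ transportAct F φ r =
      transportAct F φ ((β_ X A).hom ≫ (β_ A X).hom ≫ r) := by
  rw [braiding_comp_transportAct, transportAct, map_comp _ (β_ X A).hom, LaxBraided.braided_assoc]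
  simp

end Braided

end TransportAct

namespace RMod

variable {C : Type*} [Category* C] [MonoidalCategory C] {D : Type*} [Category* D]
  [MonoidalCategory D]

/-- The module structure on `Y` carried over from `N` along an isomorphism of underlying
objects. -/
@[simps]
def ofIso {B : D} [MonObj B] (N : RMod B) {Y : D} (e : Y ≅ N.X) : RMod B where
  X := Y
  act := e.hom ▷ B ≫ N.act ≫ e.inv
  act_one := by
    rw [whisker_exchange_assoc, reassoc_of% N.act_one, rightUnitor_naturality_assoc, e.hom_inv_id,
      Category.comp_id]
  act_mul := by
    rw [whisker_exchange_assoc, reassoc_of% N.act_mul]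
    simp

lemma IsLocal.of_iso [BraidedCategory D] {B : D} [MonObj B] {M N : RMod B} (e : M ≅ N)
    (h : M.IsLocal) : N.IsLocal := by
  have inv_hom : e.inv.hom ≫ e.hom.hom = 𝟙 N.X := congrArg Hom.hom e.inv_hom_id
  have act_eq : N.act = e.inv.hom ▷ B ≫ M.act ≫ e.hom.hom := by
    rw [e.hom.comm, ← comp_whiskerRight_assoc, inv_hom, id_whiskerRight, Category.id_comp]
  unfold IsLocal at h ⊢
  rw [act_eq, ← BraidedCategory.braiding_naturality_right_assoc,
    ← BraidedCategory.braiding_naturality_left_assoc, reassoc_of% h]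

variable (F : C ⥤ D) {A : C} [MonObj A] {B : D} [MonObj B] (φ : B ⟶ F.obj A)

section Lax

variable [F.LaxMonoidal] [IsMonHom φ]

/-- The `B`-module `F(M)` obtained from an `A`-module `M` by a lax monoidal functor `F` and an
algebra map `φ : B ⟶ F(A)`. -/
abbrev transportObj (M : RMod A) : RMod B where
  X := F.obj M.X
  act := transportAct F φ M.act
  act_one := by
    rw [whiskerLeft_one_comp_transportAct, M.act_one, LaxMonoidal.right_unitality]
  act_mul := by
    rw [whiskerLeft_mul_comp_transportAct, transportAct_whiskerRight_comp_transportAct, M.act_mul]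

/-- The action of `transportObj` on module maps. -/
abbrev transportMap {M N : RMod A} (f : M ⟶ N) : transportObj F φ M ⟶ transportObj F φ N where
  hom := F.map f.hom
  comm := by
    rw [transportAct_comp_map, f.comm, map_whiskerRight_comp_transportAct]

lemma transportMap_id (M : RMod A) : transportMap F φ (𝟙 M) = 𝟙 (transportObj F φ M) :=
  hom_ext (F.map_id _)

/-- Transport of modules as a functor. -/
def transport : RMod A ⥤ RMod B where
  obj := transportObj F φ
  map := transportMap F φ
  map_id := transportMap_id F φ
  map_comp _ _ := hom_ext (F.map_comp _ _)

instance [F.Faithful] : (transport F φ).Faithful where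
  map_injective h := hom_ext (F.map_injective (congrArg Hom.hom h))

/-- The map `B ⟶ F(A)` as a map of `B`-modules. -/
def transportUnitHom : regular B ⟶ transportObj F φ (regular A) where
  hom := φ
  comm := by
    change μ[B] ≫ φ = φ ▷ B ≫ F.obj A ◁ φ ≫ μ[F.obj A]
    rw [IsMonHom.mul_hom, MonoidalCategory.tensorHom_def, Category.assoc]

/-- The isomorphism `B ≅ F(A)` as an isomorphism of `B`-modules. -/
noncomputable def transportUnitIso [IsIso φ] :
    regular B ≅ transportObj F φ (regular A) :=
  isoMk (asIso φ) (transportUnitHom F φ).comm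

end Lax

section Strong

variable [F.Monoidal] [IsMonHom φ] [IsIso φ]

instance [F.Full] [F.Faithful] : (transport F φ).Full where
  map_surjective {M N} f := by
    obtain ⟨g, hg⟩ := F.map_surjective f.hom
    refine ⟨⟨g, transportAct_injective F φ ?_⟩, hom_ext hg⟩
    rw [← transportAct_comp_map, ← map_whiskerRight_comp_transportAct, hg]
    exact f.comm

lemma exists_transportObj_iso [F.Full] [F.Faithful] (N : RMod B) {X : C} (e : F.obj X ≅ N.X) :
    ∃ M : RMod A, Nonempty (transportObj F φ M ≅ N) := by
  obtain ⟨r, hr⟩ := transportAct_surjective F φ (N.ofIso e).act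
  let M : RMod A :=
    { X := X
      act := r
      act_one := by
        rw [← whiskerLeft_one_comp_transportAct_eq_iff F φ, hr]
        exact (N.ofIso e).act_one
      act_mul := by
        rw [← whiskerLeft_mul_comp_transportAct_eq_iff F φ, hr]
        exact (N.ofIso e).act_mul }
  exact ⟨M, ⟨isoMk e (by simp [M, hr])⟩⟩

instance [F.IsEquivalence] : (transport F φ).EssSurj where
  mem_essImage N := exists_transportObj_iso F φ N (F.objObjPreimageIso N.X)

end Strong

section Braided

variable [BraidedCategory C] [BraidedCategory D]

lemma transportObj_lact [F.LaxBraided] [IsMonHom φ] (M : RMod A) :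
    (transportObj F φ M).lact = φ ▷ F.obj M.X ≫ LaxMonoidal.μ F A M.X ≫ F.map M.lact :=
  braiding_comp_transportAct F φ M.act

lemma IsLocal.transportObj [F.LaxBraided] [IsMonHom φ] {M : RMod A} (hM : M.IsLocal) :
    (transportObj F φ M).IsLocal :=
  (braiding_braiding_comp_transportAct F φ M.act).trans (congrArg _ hM)

lemma IsLocal.of_transportObj [F.Braided] [F.Faithful] [IsMonHom φ] [IsIso φ] {M : RMod A}
    (hM : (RMod.transportObj F φ M).IsLocal) : M.IsLocal :=
  transportAct_injective F φ ((braiding_braiding_comp_transportAct F φ M.act).symm.trans hM)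

end Braided

section Coequalizer

variable {C : Type*} [Category* C] [MonoidalCategory C] [BraidedCategory C] [HasCoequalizers C]
  [∀ Z : C, PreservesColimitsOfShape WalkingParallelPair (tensorLeft Z)] {A : C} [MonObj A]
  [IsCommMonObj A] {D : Type*} [Category* D] (F : C ⥤ D)
  [PreservesColimitsOfShape WalkingParallelPair F]

/-- The coequalizer that defines `M ⊗_A N` stays one after applying `F`. -/
noncomputable def isColimitMapProj (M N : RMod A) :
    IsColimit (Cofork.ofπ (f := F.map (M.act ▷ N.X))
      (g := F.map ((α_ M.X A N.X).hom ≫ M.X ◁ N.lact)) (F.map (proj M N))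
      (by rw [← map_comp, proj_balanced, ← map_comp, Category.assoc])) :=
  isColimitOfHasCoequalizerOfPreservesColimit F _ _

lemma epi_map_proj (M N : RMod A) :
    Epi (F.map (proj M N)) :=
  epi_of_isColimit_cofork (isColimitMapProj F M N)

end Coequalizer

section BalancedSource

variable [BraidedCategory C] [HasCoequalizers C]
  [∀ Z : C, PreservesColimitsOfShape WalkingParallelPair (tensorLeft Z)] [IsCommMonObj A]

lemma μ_comp_map_proj_balanced [BraidedCategory D] [F.LaxBraided] [IsMonHom φ] (M N : RMod A) :
    (transportObj F φ M).act ▷ F.obj N.X ≫ LaxMonoidal.μ F M.X N.X ≫ F.map (proj M N) =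
      (α_ _ _ _).hom ≫ F.obj M.X ◁ (transportObj F φ N).lact ≫
        LaxMonoidal.μ F M.X N.X ≫ F.map (proj M N) := by
  have balanced := congrArg F.map (proj_balanced M N)
  simp only [map_comp] at balanced
  rw [transportObj_lact]
  simp only [transportAct, comp_whiskerRight, MonoidalCategory.whiskerLeft_comp, Category.assoc,
    μ_natural_left_assoc, μ_natural_right_assoc, balanced]
  rw [LaxMonoidal.associativity_assoc, associator_naturality_middle_assoc]

end BalancedSource

section BalancedTarget

variable [BraidedCategory D] [HasCoequalizers D]
  [∀ Z : D, PreservesColimitsOfShape WalkingParallelPair (tensorLeft Z)] [IsCommMonObj B]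

lemma δ_comp_proj_balanced [BraidedCategory C] [F.Braided] [IsMonHom φ] [IsIso φ] (M N : RMod A) :
    F.map (M.act ▷ N.X) ≫ OplaxMonoidal.δ F M.X N.X ≫
        proj (transportObj F φ M) (transportObj F φ N) =
      F.map ((α_ M.X A N.X).hom ≫ M.X ◁ N.lact) ≫ OplaxMonoidal.δ F M.X N.X ≫
        proj (transportObj F φ M) (transportObj F φ N) := by
  have balanced := proj_balanced (transportObj F φ M) (transportObj F φ N)
  rw [transportObj_lact] at balanced
  simp only [transportAct, comp_whiskerRight, MonoidalCategory.whiskerLeft_comp,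
    Category.assoc] at balanced
  rw [← cancel_epi (LaxMonoidal.μ F (M.X ⊗ A) N.X), ← cancel_epi (LaxMonoidal.μ F M.X A ▷ _),
    ← cancel_epi ((F.obj M.X ◁ φ) ▷ _)]
  simp only [← μ_natural_left_assoc, ← μ_natural_right_assoc, Functor.map_comp, Category.assoc,
    LaxMonoidal.associativity_assoc, Functor.Monoidal.μ_δ_assoc]
  rw [balanced, associator_naturality_middle_assoc]

end BalancedTarget

section Tensor

variable [BraidedCategory C] [HasCoequalizers C]
  [∀ Z : C, PreservesColimitsOfShape WalkingParallelPair (tensorLeft Z)] [IsCommMonObj A]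
  [BraidedCategory D] [HasCoequalizers D]
  [∀ Z : D, PreservesColimitsOfShape WalkingParallelPair (tensorLeft Z)] [IsCommMonObj B]

section LaxBraided

variable [F.LaxBraided] [IsMonHom φ]

/-- The map `F(M) ⊗_B F(N) ⟶ F(M ⊗_A N)` induced by the tensorator of `F`. -/
noncomputable def transportTensorHom (M N : RMod A) :
    tens (transportObj F φ M) (transportObj F φ N) ⟶ transportObj F φ (tens M N) where
  hom := desc (LaxMonoidal.μ F M.X N.X ≫ F.map (proj M N)) (μ_comp_map_proj_balanced F φ M N)
  comm := by
    have act := congrArg F.map (proj_act M N)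
    simp only [map_comp] at act
    rw [← cancel_epi (proj (transportObj F φ M) (transportObj F φ N) ▷ B), ← Category.assoc,
      proj_act, ← comp_whiskerRight_assoc, proj_desc]
    simp only [transportAct, Category.assoc, proj_desc, comp_whiskerRight,
      MonoidalCategory.whiskerLeft_comp, μ_natural_right_assoc]
    rw [← whisker_exchange_assoc, μ_natural_left_assoc, act, ← whisker_exchange_assoc,
      LaxMonoidal.associativity_assoc]
    simp

@[simp]
lemma proj_transportTensorHom (M N : RMod A) :
    proj (transportObj F φ M) (transportObj F φ N) ≫ (transportTensorHom F φ M N).hom =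
      LaxMonoidal.μ F M.X N.X ≫ F.map (proj M N) :=
  proj_desc _ (μ_comp_map_proj_balanced F φ M N)

@[simp]
lemma proj_transportTensorHom_assoc (M N : RMod A) {Y : D} (k : F.obj (tens M N).X ⟶ Y) :
    proj (transportObj F φ M) (transportObj F φ N) ≫ (transportTensorHom F φ M N).hom ≫ k =
      LaxMonoidal.μ F M.X N.X ≫ F.map (proj M N) ≫ k := by
  rw [← Category.assoc, proj_transportTensorHom, Category.assoc]

lemma tensMap_comp_transportTensorHom {M M' N N' : RMod A} (f : M ⟶ M') (g : N ⟶ N') :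
    tensMap (transportMap F φ f) (transportMap F φ g) ≫ transportTensorHom F φ M' N' =
      transportTensorHom F φ M N ≫ transportMap F φ (tensMap f g) := by
  apply tens_ext
  simp only [comp_hom, proj_tensMap_assoc, proj_transportTensorHom, proj_transportTensorHom_assoc,
    μ_natural_assoc, ← Functor.map_comp, proj_tensMap]

lemma transportTensorHom_associativity (M N P : RMod A) :
    tensMap (transportTensorHom F φ M N) (𝟙 (transportObj F φ P)) ≫
        transportTensorHom F φ (tens M N) P ≫ transportMap F φ (assoc M N P).hom =
      (assoc (transportObj F φ M) (transportObj F φ N) (transportObj F φ P)).hom ≫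
        tensMap (𝟙 (transportObj F φ M)) (transportTensorHom F φ N P) ≫
          transportTensorHom F φ M (tens N P) := by
  apply tens_ext₃
  have map_assoc := congrArg F.map (proj_assoc M N P)
  simp only [Functor.map_comp] at map_assoc
  have assoc_transport :=
    proj_assoc (transportObj F φ M) (transportObj F φ N) (transportObj F φ P)
  simp only [comp_hom, proj_tensMap_assoc, proj_transportTensorHom_assoc, id_hom, tensorHom_id]
  rw [reassoc_of% assoc_transport, proj_tensMap_assoc, proj_transportTensorHom, id_hom,
    id_tensorHom, ← comp_whiskerRight_assoc, ← MonoidalCategory.whiskerLeft_comp_assoc,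
    proj_transportTensorHom, proj_transportTensorHom]
  simp only [comp_whiskerRight, MonoidalCategory.whiskerLeft_comp, Category.assoc,
    μ_natural_left_assoc, μ_natural_right_assoc, map_assoc, LaxMonoidal.associativity_assoc]

lemma transportTensorHom_braid (M N : RMod A) (hM : M.IsLocal) :
    transportTensorHom F φ M N ≫ transportMap F φ (braid M N hM).hom =
      (braid (transportObj F φ M) (transportObj F φ N) (hM.transportObj F φ)).hom ≫
        transportTensorHom F φ N M := by
  apply tens_ext
  have map_braid := congrArg F.map (proj_braid M N hM)
  simp only [Functor.map_comp] at map_braid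
  simp only [comp_hom, reassoc_of% proj_braid, proj_transportTensorHom_assoc,
    proj_transportTensorHom, map_braid, LaxBraided.braided_assoc]

lemma transport_left_unitality (M : RMod A) :
    (lUnitor (transportObj F φ M)).hom =
      tensMap (transportUnitHom F φ) (𝟙 (transportObj F φ M)) ≫
        transportTensorHom F φ (regular A) M ≫ transportMap F φ (lUnitor M).hom := by
  apply tens_ext
  simp only [comp_hom, proj_tensMap_assoc, proj_transportTensorHom_assoc, proj_lUnitor,
    ← Functor.map_comp, transportObj_lact, id_hom, tensorHom_id, transportUnitHom]

lemma transport_right_unitality (M : RMod A) :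
    (rUnitor (transportObj F φ M)).hom =
      tensMap (𝟙 (transportObj F φ M)) (transportUnitHom F φ) ≫
        transportTensorHom F φ M (regular A) ≫ transportMap F φ (rUnitor M).hom := by
  apply tens_ext
  simp only [comp_hom, proj_tensMap_assoc, proj_transportTensorHom_assoc, proj_rUnitor,
    ← Functor.map_comp, id_hom, id_tensorHom, transportUnitHom, transportAct]

end LaxBraided

section Braided

variable [F.Braided] [IsMonHom φ] [IsIso φ] [PreservesColimitsOfShape WalkingParallelPair F]

/-- The inverse of `transportTensorHom` on underlying objects. It exists because `F` preserves the
coequalizer that defines `M ⊗_A N`. -/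
noncomputable def transportTensorInv (M N : RMod A) :
    F.obj (tens M N).X ⟶ (tens (transportObj F φ M) (transportObj F φ N)).X :=
  Cofork.IsColimit.desc (isColimitMapProj F M N) _ (δ_comp_proj_balanced F φ M N)

@[simp]
lemma map_proj_transportTensorInv (M N : RMod A) :
    F.map (proj M N) ≫ transportTensorInv F φ M N =
      OplaxMonoidal.δ F M.X N.X ≫ proj (transportObj F φ M) (transportObj F φ N) :=
  Cofork.IsColimit.π_desc' (isColimitMapProj F M N) _ _

/-- The isomorphism `F(M) ⊗_B F(N) ≅ F(M ⊗_A N)` induced by the tensorator of `F`. -/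
noncomputable def transportTensorIso (M N : RMod A) :
    tens (transportObj F φ M) (transportObj F φ N) ≅ transportObj F φ (tens M N) :=
  isoMk
    { hom := (transportTensorHom F φ M N).hom
      inv := transportTensorInv F φ M N
      hom_inv_id := by rw [← cancel_epi (proj _ _)]; simp
      inv_hom_id := by
        have := epi_map_proj F M N
        rw [← cancel_epi (F.map (proj M N)), ← Category.assoc, map_proj_transportTensorInv]; simp }
    (transportTensorHom F φ M N).comm

end Braided

end Tensor

end RMod

section LocalModules

variable {C : Type*} [Category* C] [MonoidalCategory C] [BraidedCategory C]
  {D : Type*} [Category* D] [MonoidalCategory D] [BraidedCategory D]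
  (F : C ⥤ D) {A : C} [MonObj A] {B : D} [MonObj B] (φ : B ⟶ F.obj A)

/-- Transport of modules along a braided functor, restricted to local modules. -/
def transportLoc [F.LaxBraided] [IsMonHom φ] : LocMod A ⥤ LocMod B :=
  (isLocal B).lift ((isLocal A).ι ⋙ RMod.transport F φ) fun M => M.property.transportObj F φ

instance [F.LaxBraided] [IsMonHom φ] [F.Faithful] : (transportLoc F φ).Faithful :=
  Functor.Faithful.of_comp_iso (H := (isLocal A).ι ⋙ RMod.transport F φ) (G := (isLocal B).ι)
    (Iso.refl _)

section Equivalence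

variable [F.Braided] [IsMonHom φ] [IsIso φ]

instance [F.Full] [F.Faithful] : (transportLoc F φ).Full :=
  Functor.Full.of_comp_faithful_iso (H := (isLocal A).ι ⋙ RMod.transport F φ)
    (G := (isLocal B).ι) (Iso.refl _)

instance [F.IsEquivalence] : (transportLoc F φ).EssSurj where
  mem_essImage N := by
    let e := (RMod.transport F φ).objObjPreimageIso N.obj
    exact ⟨⟨_, .of_transportObj F φ (.of_iso e.symm N.property)⟩, ⟨(isLocal B).isoMk e⟩⟩

instance [F.IsEquivalence] : (transportLoc F φ).IsEquivalence where

end Equivalence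

section Linear

variable [Preadditive C] [Linear ℂ C] [MonoidalPreadditive C] [MonoidalLinear ℂ C]
  [Preadditive D] [Linear ℂ D] [MonoidalPreadditive D] [MonoidalLinear ℂ D]
  [F.LaxBraided] [IsMonHom φ] [F.Additive]

instance : (transportLoc F φ).Additive where
  map_add := ObjectProperty.hom_ext _ (RMod.hom_ext F.map_add)

instance [F.Linear ℂ] : (transportLoc F φ).Linear ℂ where
  map_smul f c := ObjectProperty.hom_ext _ (RMod.hom_ext (F.map_smul c f.hom.hom))

end Linear

section Monoidal

variable [HasCoequalizers C]
  [∀ Z : C, PreservesColimitsOfShape WalkingParallelPair (tensorLeft Z)] [IsCommMonObj A]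
  [HasCoequalizers D]
  [∀ Z : D, PreservesColimitsOfShape WalkingParallelPair (tensorLeft Z)] [IsCommMonObj B]

open RMod

lemma isMonoidal_of_proj {𝒯 : Type*} [Category* 𝒯] [MonoidalCategory 𝒯] {S T : 𝒯 ⥤ LocMod B}
    [S.LaxMonoidal] [T.LaxMonoidal] (t : S ⟶ T)
    (unit : (ε S).hom.hom ≫ (t.app (𝟙_ 𝒯)).hom.hom = (ε T).hom.hom)
    (tensor : ∀ X Y : 𝒯,
      proj (S.obj X).obj (S.obj Y).obj ≫ (LaxMonoidal.μ S X Y).hom.hom ≫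
          (t.app (X ⊗ Y)).hom.hom =
        ((t.app X).hom.hom ⊗ₘ (t.app Y).hom.hom) ≫ proj (T.obj X).obj (T.obj Y).obj ≫
          (LaxMonoidal.μ T X Y).hom.hom) :
    NatTrans.IsMonoidal t where
  unit := ObjectProperty.hom_ext _ (RMod.hom_ext unit)
  tensor X Y := ObjectProperty.hom_ext _ (tens_ext
    ((tensor X Y).trans (proj_tensMap_assoc (t.app X).hom (t.app Y).hom _).symm))

variable [F.Braided] [IsMonHom φ] [IsIso φ] [PreservesColimitsOfShape WalkingParallelPair F]

noncomputable instance : (transportLoc F φ).Monoidal :=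
  Functor.CoreMonoidal.toMonoidal
    { εIso := (isLocal B).isoMk (transportUnitIso F φ)
      μIso := fun M N => (isLocal B).isoMk (transportTensorIso F φ M.obj N.obj)
      μIso_hom_natural_left := fun f N => ObjectProperty.hom_ext _ <| by
        have natural := tensMap_comp_transportTensorHom F φ f.hom (𝟙 N.obj)
        rwa [transportMap_id] at natural
      μIso_hom_natural_right := fun M f => ObjectProperty.hom_ext _ <| by
        have natural := tensMap_comp_transportTensorHom F φ (𝟙 M.obj) f.hom
        rwa [transportMap_id] at natural
      associativity := fun M N P =>
        ObjectProperty.hom_ext _ (transportTensorHom_associativity F φ M.obj N.obj P.obj)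
      left_unitality := fun M => ObjectProperty.hom_ext _ (transport_left_unitality F φ M.obj)
      right_unitality := fun M => ObjectProperty.hom_ext _ (transport_right_unitality F φ M.obj) }

noncomputable instance : (transportLoc F φ).Braided where
  braided M N := ObjectProperty.hom_ext _ (transportTensorHom_braid F φ M.obj N.obj M.property)

lemma proj_transportLoc_μ (M N : LocMod A) :
    proj (transportObj F φ M.obj) (transportObj F φ N.obj) ≫
        (LaxMonoidal.μ (transportLoc F φ) M N).hom.hom =
      LaxMonoidal.μ F M.obj.X N.obj.X ≫ F.map (proj M.obj N.obj) :=
  proj_transportTensorHom F φ M.obj N.obj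

lemma proj_transportLoc_μ_assoc (M N : LocMod A) {Y : D} (k : F.obj (M ⊗ N).obj.X ⟶ Y) :
    proj (transportObj F φ M.obj) (transportObj F φ N.obj) ≫
        (LaxMonoidal.μ (transportLoc F φ) M N).hom.hom ≫ k =
      LaxMonoidal.μ F M.obj.X N.obj.X ≫ F.map (proj M.obj N.obj) ≫ k :=
  proj_transportTensorHom_assoc F φ M.obj N.obj k

end Monoidal

end LocalModules

section TransportLocIsos

variable {C : Type*} [Category* C] [MonoidalCategory C] [BraidedCategory C]
  {D : Type*} [Category* D] [MonoidalCategory D] [BraidedCategory D]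
  {E : Type*} [Category* E] [MonoidalCategory E] [BraidedCategory E]
  {A : C} [MonObj A] {B : D} [MonObj B] {B' : E} [MonObj B']

/-- Transport is functorial in monoidal natural isomorphisms compatible with the algebra maps. -/
def transportLocIso {F F' : C ⥤ D} [F.LaxBraided] [F'.LaxBraided] (φ : B ⟶ F.obj A)
    (φ' : B ⟶ F'.obj A) [IsMonHom φ] [IsMonHom φ'] (θ : F ≅ F') [NatTrans.IsMonoidal θ.hom]
    (h : φ ≫ θ.hom.app A = φ') : transportLoc F φ ≅ transportLoc F' φ' :=
  NatIso.ofComponents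
    (fun M => (isLocal B).isoMk (RMod.isoMk (M := RMod.transportObj F φ M.obj)
      (N := RMod.transportObj F' φ' M.obj) (θ.app M.obj.X)
      (by subst h; exact (whiskerRight_app_comp_transportAct F φ θ.hom M.obj.act).symm)))
    (fun f => ObjectProperty.hom_ext _ (RMod.hom_ext (θ.hom.naturality f.hom.hom)))

/-- Transporting twice is transport along the composite functor; on underlying objects this is the
identity. -/
def transportLocCompIso (F : C ⥤ D) (H : D ⥤ E) [F.LaxBraided] [H.LaxBraided]
    (φ : B ⟶ F.obj A) (κ : B' ⟶ H.obj B) (ψ : B' ⟶ (F ⋙ H).obj A) [IsMonHom φ] [IsMonHom κ]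
    [IsMonHom ψ] (h : κ ≫ H.map φ = ψ) :
    transportLoc F φ ⋙ transportLoc H κ ≅ transportLoc (F ⋙ H) ψ :=
  NatIso.ofComponents
    (fun M => (isLocal B').isoMk (RMod.isoMk
      (M := RMod.transportObj H κ (RMod.transportObj F φ M.obj))
      (N := RMod.transportObj (F ⋙ H) ψ M.obj) (Iso.refl _)
      (by subst h; simp [transportAct_comp])))
    (fun f => ObjectProperty.hom_ext _
      (RMod.hom_ext ((Category.comp_id _).trans (Category.id_comp _).symm)))

/-- Transport along the identity functor is the identity, also on underlying objects. -/
def transportLocIdIso (ψ : A ⟶ (𝟭 C).obj A) [IsMonHom ψ] (h : ψ = 𝟙 A) :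
    𝟭 (LocMod A) ≅ transportLoc (𝟭 C) ψ :=
  NatIso.ofComponents
    (fun M => (isLocal A).isoMk (RMod.isoMk (M := M.obj)
      (N := RMod.transportObj (𝟭 C) ψ M.obj) (Iso.refl _)
      (by subst h; simp [transportAct_id])))
    (fun f => ObjectProperty.hom_ext _
      (RMod.hom_ext ((Category.comp_id _).trans (Category.id_comp _).symm)))

variable [HasCoequalizers C]
  [∀ Z : C, PreservesColimitsOfShape WalkingParallelPair (tensorLeft Z)] [IsCommMonObj A]
  [HasCoequalizers D]
  [∀ Z : D, PreservesColimitsOfShape WalkingParallelPair (tensorLeft Z)] [IsCommMonObj B]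

lemma isMonoidal_transportLocIso {F F' : C ⥤ D} [F.Braided] [F'.Braided]
    [PreservesColimitsOfShape WalkingParallelPair F]
    [PreservesColimitsOfShape WalkingParallelPair F'] (φ : B ⟶ F.obj A) (φ' : B ⟶ F'.obj A)
    [IsMonHom φ] [IsMonHom φ'] [IsIso φ] [IsIso φ'] (θ : F ≅ F') [NatTrans.IsMonoidal θ.hom]
    (h : φ ≫ θ.hom.app A = φ') : NatTrans.IsMonoidal (transportLocIso φ φ' θ h).hom := by
  refine isMonoidal_of_proj _ h fun M N => ?_
  have natural : F.map (RMod.proj M.obj N.obj) ≫ θ.hom.app (M ⊗ N).obj.X =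
      θ.hom.app (M.obj.X ⊗ N.obj.X) ≫ F'.map (RMod.proj M.obj N.obj) := θ.hom.naturality _
  have tensor := NatTrans.IsMonoidal.tensor (τ := θ.hom) M.obj.X N.obj.X
  calc
    _ = LaxMonoidal.μ F M.obj.X N.obj.X ≫ F.map (RMod.proj M.obj N.obj) ≫
          θ.hom.app (M ⊗ N).obj.X := proj_transportLoc_μ_assoc F φ M N _
    _ = (θ.hom.app M.obj.X ⊗ₘ θ.hom.app N.obj.X) ≫ LaxMonoidal.μ F' M.obj.X N.obj.X ≫
          F'.map (RMod.proj M.obj N.obj) := by rw [natural, reassoc_of% tensor]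
    _ = _ := congrArg (_ ≫ ·) (proj_transportLoc_μ F' φ' M N).symm

lemma isMonoidal_transportLocIdIso (ψ : A ⟶ (𝟭 C).obj A) [IsMonHom ψ] [IsIso ψ] (h : ψ = 𝟙 A) :
    NatTrans.IsMonoidal (transportLocIdIso ψ h).hom := by
  refine isMonoidal_of_proj _ ((Category.id_comp _).trans h.symm) fun M N => ?_
  calc
    _ = RMod.proj M.obj N.obj ≫ 𝟙 _ ≫ 𝟙 _ := rfl
    _ = (𝟙 M.obj.X ⊗ₘ 𝟙 N.obj.X) ≫ LaxMonoidal.μ (𝟭 C) M.obj.X N.obj.X ≫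
          (𝟭 C).map (RMod.proj M.obj N.obj) := by simp
    _ = _ := congrArg (_ ≫ ·) (proj_transportLoc_μ (𝟭 C) ψ M N).symm

variable [HasCoequalizers E]
  [∀ Z : E, PreservesColimitsOfShape WalkingParallelPair (tensorLeft Z)] [IsCommMonObj B']

lemma proj_transportTensorHom_comp (F : C ⥤ D) (H : D ⥤ E) [F.LaxBraided] [H.LaxBraided]
    (φ : B ⟶ F.obj A) (κ : B' ⟶ H.obj B) [IsMonHom φ] [IsMonHom κ] (M N : RMod A) :
    RMod.proj (RMod.transportObj H κ (RMod.transportObj F φ M))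
        (RMod.transportObj H κ (RMod.transportObj F φ N)) ≫
        (RMod.transportTensorHom H κ (RMod.transportObj F φ M) (RMod.transportObj F φ N)).hom ≫
          H.map (RMod.transportTensorHom F φ M N).hom =
      LaxMonoidal.μ (F ⋙ H) M.X N.X ≫ (F ⋙ H).map (RMod.proj M N) := by
  rw [RMod.proj_transportTensorHom_assoc, ← H.map_comp, RMod.proj_transportTensorHom]
  simp

lemma isMonoidal_transportLocCompIso (F : C ⥤ D) (H : D ⥤ E) [F.Braided] [H.Braided]
    [PreservesColimitsOfShape WalkingParallelPair F]
    [PreservesColimitsOfShape WalkingParallelPair H]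
    (φ : B ⟶ F.obj A) (κ : B' ⟶ H.obj B) (ψ : B' ⟶ (F ⋙ H).obj A) [IsMonHom φ] [IsMonHom κ]
    [IsMonHom ψ] [IsIso φ] [IsIso κ] [IsIso ψ] (h : κ ≫ H.map φ = ψ) :
    NatTrans.IsMonoidal (transportLocCompIso F H φ κ ψ h).hom := by
  refine isMonoidal_of_proj _ ((Category.comp_id _).trans h) fun M N => ?_
  calc
    _ = LaxMonoidal.μ (F ⋙ H) M.obj.X N.obj.X ≫ (F ⋙ H).map (RMod.proj M.obj N.obj) :=
          (congrArg (_ ≫ ·) (Category.comp_id _)).trans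
            (proj_transportTensorHom_comp F H φ κ M.obj N.obj)
    _ = (𝟙 ((F ⋙ H).obj M.obj.X) ⊗ₘ 𝟙 ((F ⋙ H).obj N.obj.X)) ≫
          LaxMonoidal.μ (F ⋙ H) M.obj.X N.obj.X ≫ (F ⋙ H).map (RMod.proj M.obj N.obj) := by
          rw [id_tensorHom_id, Category.id_comp]
    _ = _ := congrArg (_ ≫ ·) (proj_transportLoc_μ (F ⋙ H) ψ M N).symm

end TransportLocIsos

section Twist

variable {C : Type u} [Category.{v} C] [Preadditive C] [Linear ℂ C] [MonoidalCategory C]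
  [BraidedCategory C] {A : C} [MonObj A]

instance (p : AutPair A) : IsMonHom p.lam.iso.inv :=
  have := p.lam.isMonHom
  inferInstance

lemma lam_inv_comp_app {p q : AutPair A} (f : p ⟶ q) :
    p.lam.iso.inv ≫ AutBr.app f.hom A = q.lam.iso.inv := by
  rw [Iso.inv_comp_eq, ← f.comm, Category.assoc, Iso.hom_inv_id, Category.comp_id]

variable [MonoidalPreadditive C] [MonoidalLinear ℂ C] [HasCoequalizers C]
  [∀ Z : C, PreservesColimitsOfShape WalkingParallelPair (tensorLeft Z)] [IsCommMonObj A]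

/-- Twisting by the pair `p` as a braided autoequivalence of the category of local modules. -/
noncomputable def twistAut (p : AutPair A) : AutBr (LocMod A) where
  functor := transportLoc p.aut.functor p.lam.iso.inv
  braided := inferInstance
  isEquivalence := inferInstance
  additive := inferInstance
  linear := inferInstance

variable (A) in
/-- Twisting as a functor of the pair. -/
noncomputable def twistFunctor : AutPair A ⥤ AutBr (LocMod A) where
  obj := twistAut
  map f := ⟨transportLocIso _ _ f.hom.iso (lam_inv_comp_app f),
    isMonoidal_transportLocIso _ _ _ _⟩
  map_id _ := rfl
  map_comp _ _ := rfl

/-- The identification of twisting twice with twisting by the composite pair. -/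
noncomputable def twistCompIso (p q : AutPair A) : twistAut p ⊗ twistAut q ≅ twistAut (p ⊗ q) :=
  AutBr.isoMk (transportLocCompIso q.aut.functor p.aut.functor q.lam.iso.inv p.lam.iso.inv
    (p ⊗ q).lam.iso.inv rfl) (isMonoidal_transportLocCompIso _ _ _ _ _ _)

variable (A) in
/-- The identification of twisting by the unit pair with the identity. -/
noncomputable def twistUnitIso : 𝟙_ (AutBr (LocMod A)) ≅ twistAut (𝟙_ (AutPair A)) :=
  AutBr.isoMk (transportLocIdIso (𝟙_ (AutPair A)).lam.iso.inv rfl)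
    (isMonoidal_transportLocIdIso _ _)

lemma AutBr.locMod_hom_ext {a b : AutBr (LocMod A)} {f g : a ⟶ b}
    (h : ∀ M, (AutBr.app f M).hom.hom = (AutBr.app g M).hom.hom) : f = g :=
  AutBr.hom_ext fun M => ObjectProperty.hom_ext _ (RMod.hom_ext (h M))

noncomputable instance : (twistFunctor A).Monoidal :=
  Functor.CoreMonoidal.toMonoidal
    { εIso := twistUnitIso A
      μIso := twistCompIso
      μIso_hom_natural_left := fun _ _ => AutBr.locMod_hom_ext fun _ =>
        (Category.comp_id _).trans (Category.id_comp _).symm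
      μIso_hom_natural_right := fun _ _ => AutBr.locMod_hom_ext fun _ =>
        (Category.comp_id _).trans (Category.id_comp _).symm
      associativity := fun p q r => AutBr.locMod_hom_ext fun M => by
        change 𝟙 _ ≫ 𝟙 _ ≫ 𝟙 _ = 𝟙 _ ≫ p.aut.functor.map (𝟙 _) ≫ 𝟙 _
        simp
      left_unitality := fun p => AutBr.locMod_hom_ext fun M => by
        change 𝟙 _ = 𝟙 _ ≫ 𝟙 _ ≫ 𝟙 _
        simp
      right_unitality := fun p => AutBr.locMod_hom_ext fun M => by
        change 𝟙 _ = p.aut.functor.map (𝟙 _) ≫ 𝟙 _ ≫ 𝟙 _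
        simp }

variable (A) in
/-- Twisting as a strong monoidal functor, denoted `F_A` in the informal statement. -/
noncomputable def twistStrong : StrongMonoidalFunctor (AutPair A) (AutBr (LocMod A)) :=
  ⟨twistFunctor A, inferInstance⟩

/-- The identification of the underlying functor of `twistAut p` with `twist p`; it is the identity
because `twist p` unfolds to transport along `λ⁻¹`. -/
noncomputable def twistIso (p : AutPair A) : TwistIso p (twistAut p) where
  iso := Iso.refl _
  tensor M N := by
    refine (congrArg (_ ≫ ·) (Category.comp_id _)).trans ?_
    refine (proj_transportLoc_μ p.aut.functor p.lam.iso.inv M N).trans ?_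
    exact (Category.id_comp _).symm.trans (congrArg (· ≫ _) (id_tensorHom_id _ _).symm)
  unit := Category.comp_id _

variable (A) in
/-- The identifications that exhibit `twistStrong A` as twisting. -/
noncomputable def twistFunctorData : TwistFunctorData (twistStrong A) where
  tw := twistIso
  map _ _ := (Category.comp_id _).trans (Category.id_comp _).symm
  tensor p _ _ := congrArg (𝟙 _ ≫ ·) (p.aut.functor.map_id _).symm
  unit _ := Category.comp_id _

end Twist

lemma StrongMonoidalFunctor.ext_of_lax {𝒢 : Type*} [Category* 𝒢] [MonoidalCategory 𝒢]
    {ℋ : Type*} [Category* ℋ] [MonoidalCategory ℋ] {F : 𝒢 ⥤ ℋ} (m m' : F.Monoidal)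
    (hε : m.ε = m'.ε) (hμ : ∀ X Y, m.μ X Y = m'.μ X Y) :
    (⟨F, m⟩ : StrongMonoidalFunctor 𝒢 ℋ) = ⟨F, m'⟩ :=
  congrArg (StrongMonoidalFunctor.mk F) <|
    Functor.Monoidal.toLaxMonoidal_injective F (LaxMonoidal.ext hε (funext₂ hμ))

namespace CatAction

variable {C : Type u} [Category.{v} C] [Preadditive C] [Linear ℂ C] [MonoidalCategory C]
  [BraidedCategory C] {A : C} [MonObj A] {G : Type w} [Group G] {ρ : CatAction G C}

lemma eps_comp_mu_one (ρ : CatAction G C) (g : G) (X : C) :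
    ρ.eps ((ρ.aut g).functor.obj X) ≫ ρ.mu 1 g X ≫
        AutBr.app (ρ.toFunctor.map (λ_ (Discrete.mk g)).hom) X =
      𝟙 ((ρ.aut g).functor.obj X) :=
  congrArg (AutBr.app · X) (LaxMonoidal.left_unitality ρ.toFunctor (Discrete.mk g)).symm

namespace EquivariantAlgebra

lemma ext_lam {l l' : ρ.EquivariantAlgebra A} (h : ∀ g, l.lam g = l'.lam g) : l = l' := by
  cases l
  cases l'
  congr
  exact funext h

variable (l : ρ.EquivariantAlgebra A)

lemma map_comp_lam {x y : Discrete G} (f : x ⟶ y) :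
    AutBr.app (ρ.toFunctor.map f) A ≫ (l.lam y.as).iso.hom = (l.lam x.as).iso.hom := by
  obtain ⟨x⟩ := x
  obtain ⟨y⟩ := y
  obtain rfl : x = y := Discrete.eq_of_hom f
  rw [Subsingleton.elim f (𝟙 _), ρ.toFunctor.map_id, AutBr.id_app, Category.id_comp]

/- Equivariance at `(1, 1)` says that `1(λ¹) ≫ λ¹` is `μ_{1,1} ≫ λ¹`. Precomposed with the unit
constraint the two sides become `λ¹ ≫ ε ≫ λ¹` and `λ¹`, and `λ¹` can be cancelled. -/
lemma eps_comp_lam_one : ρ.eps A ≫ (l.lam 1).iso.hom = 𝟙 A := by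
  have eps_natural : ρ.eps _ ≫ (ρ.aut 1).functor.map (l.lam 1).iso.hom =
      (l.lam 1).iso.hom ≫ ρ.eps A := (AutBr.app_naturality ρ.unit _).symm
  have lam_mul_one : AutBr.app (ρ.toFunctor.map (λ_ (Discrete.mk (1 : G))).hom) A ≫
      (l.lam 1).iso.hom = (l.lam (1 * 1)).iso.hom := l.map_comp_lam (λ_ (Discrete.mk (1 : G))).hom
  rw [← cancel_epi (l.lam 1).iso.hom, Category.comp_id]
  calc
    (l.lam 1).iso.hom ≫ ρ.eps A ≫ (l.lam 1).iso.hom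
      = ρ.eps _ ≫ (ρ.aut 1).functor.map (l.lam 1).iso.hom ≫ (l.lam 1).iso.hom := by
        rw [reassoc_of% eps_natural]
    _ = ρ.eps _ ≫ ρ.mu 1 1 A ≫ (l.lam (1 * 1)).iso.hom := by rw [l.equivariant]
    _ = (ρ.eps _ ≫ ρ.mu 1 1 A ≫
          AutBr.app (ρ.toFunctor.map (λ_ (Discrete.mk (1 : G))).hom) A) ≫ (l.lam 1).iso.hom := by
        rw [← lam_mul_one, Category.assoc, Category.assoc]
    _ = (l.lam 1).iso.hom := by rw [eps_comp_mu_one, Category.id_comp]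

/-- The functor `g ↦ (ρ(g), λ^g)`. -/
def liftFunctor : Discrete G ⥤ AutPair A where
  obj g := ⟨ρ.aut g.as, l.lam g.as⟩
  map f := ⟨ρ.toFunctor.map f, l.map_comp_lam f⟩
  map_id _ := AutPair.hom_ext (ρ.toFunctor.map_id _)
  map_comp _ _ := AutPair.hom_ext (ρ.toFunctor.map_comp _ _)

instance : l.liftFunctor.Monoidal :=
  Functor.CoreMonoidal.toMonoidal
    { εIso := AutPair.isoMk (a := AutPair.one A) (b := l.liftFunctor.obj (Discrete.mk 1))
        (Functor.Monoidal.εIso ρ.toFunctor) l.eps_comp_lam_one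
      μIso := fun X Y => AutPair.isoMk
        (a := AutPair.comp (l.liftFunctor.obj X) (l.liftFunctor.obj Y))
        (b := l.liftFunctor.obj (X ⊗ Y))
        (Functor.Monoidal.μIso ρ.toFunctor X Y) (l.equivariant X.as Y.as).symm
      μIso_hom_natural_left := fun f X => AutPair.hom_ext (μ_natural_left ρ.toFunctor f X)
      μIso_hom_natural_right := fun X f => AutPair.hom_ext (μ_natural_right ρ.toFunctor X f)
      associativity := fun X Y Z => AutPair.hom_ext
        (LaxMonoidal.associativity ρ.toFunctor X Y Z)
      left_unitality := fun X => AutPair.hom_ext (LaxMonoidal.left_unitality ρ.toFunctor X)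
      right_unitality := fun X => AutPair.hom_ext (LaxMonoidal.right_unitality ρ.toFunctor X) }

/-- The lift `g ↦ (ρ(g), λ^g)` of the action `ρ`. -/
def toLift : ρ.Lift A where
  lift := ⟨l.liftFunctor, inferInstance⟩
  comp_forget := StrongMonoidalFunctor.ext_of_lax (F := ρ.toFunctor) _ ρ.monoidal
    (Category.id_comp _) fun _ _ => Category.id_comp _

end EquivariantAlgebra

namespace Lift

lemma ext_lift {L L' : ρ.Lift A} (h : L.lift = L'.lift) : L = L' := by
  cases L
  cases L'
  congr

lemma map_lam_comp_lam (L : StrongMonoidalFunctor (Discrete G) (AutPair A)) (x y : Discrete G) :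
    (L.toFunctor.obj x).aut.functor.map (L.toFunctor.obj y).lam.iso.hom ≫
        (L.toFunctor.obj x).lam.iso.hom =
      AutBr.app ((L.comp (AutPair.forget A)).tensorator x y) A ≫
        (L.toFunctor.obj (x ⊗ y)).lam.iso.hom := by
  have tensorator_comp : (L.comp (AutPair.forget A)).tensorator x y = (L.tensorator x y).hom :=
    Category.id_comp (L.tensorator x y).hom
  rw [tensorator_comp]
  exact (L.tensorator x y).comm.symm

/-- The algebra isomorphisms `λ^g` that a lift chooses. -/
def toEquivariantAlgebra : ρ.Lift A → ρ.EquivariantAlgebra A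
  | ⟨L, hL⟩ => hL ▸
    { lam := fun g => (L.toFunctor.obj (Discrete.mk g)).lam
      equivariant := fun g h => map_lam_comp_lam L (Discrete.mk g) (Discrete.mk h) }

lemma obj_eq (L : ρ.Lift A) (g : G) :
    L.lift.toFunctor.obj (Discrete.mk g) = ⟨ρ.aut g, L.toEquivariantAlgebra.lam g⟩ := by
  obtain ⟨L, rfl⟩ := L
  rfl

lemma toLift_toEquivariantAlgebra (L : ρ.Lift A) : L.toEquivariantAlgebra.toLift = L := by
  obtain ⟨L, rfl⟩ := L
  apply ext_lift
  refine StrongMonoidalFunctor.ext_of_lax (F := L.toFunctor) _ L.monoidal ?_ ?_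
  · exact AutPair.hom_ext (Category.id_comp _)
  · exact fun _ _ => AutPair.hom_ext (Category.id_comp _)

lemma toEquivariantAlgebra_toLift (l : ρ.EquivariantAlgebra A) :
    l.toLift.toEquivariantAlgebra = l :=
  EquivariantAlgebra.ext_lam fun g => by
    have pair_eq : (⟨ρ.aut g, l.lam g⟩ : AutPair A) =
        ⟨ρ.aut g, l.toLift.toEquivariantAlgebra.lam g⟩ := l.toLift.obj_eq g
    injection pair_eq with _ lam_eq
    exact lam_eq.symm

/-- The bijection of lifts of `ρ` with equivariant algebra structures on `A`. -/
def equivEquivariantAlgebra (ρ : CatAction G C) (A : C) [MonObj A] :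
    ρ.Lift A ≃ ρ.EquivariantAlgebra A where
  toFun := toEquivariantAlgebra
  invFun := EquivariantAlgebra.toLift
  left_inv := toLift_toEquivariantAlgebra
  right_inv := toEquivariantAlgebra_toLift

end Lift

end CatAction

section Induced

variable {C : Type u} [Category.{v} C] [Preadditive C] [Linear ℂ C] [MonoidalCategory C]
  [MonoidalPreadditive C] [MonoidalLinear ℂ C] [BraidedCategory C] [HasCoequalizers C]
  [∀ Z : C, PreservesColimitsOfShape WalkingParallelPair (tensorLeft Z)]
  {A : C} [MonObj A] [IsCommMonObj A] {G : Type w} [Group G]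

/-- The composite of the lift given by `l` with a twisting functor is the action induced by `l`. -/
def TwistFunctorData.induced {F : StrongMonoidalFunctor (AutPair A) (AutBr (LocMod A))}
    (d : TwistFunctorData F) {ρ : CatAction G C} (l : ρ.EquivariantAlgebra A) :
    InducedActionData ρ l (l.toLift.lift.comp F) where
  tw g := d.tw (l.liftFunctor.obj (Discrete.mk g))
  tensor g h M := by
    have map := d.map (l.toLift.lift.tensorator (Discrete.mk g) (Discrete.mk h)) M
    have tensor :=
      d.tensor (l.liftFunctor.obj (Discrete.mk g)) (l.liftFunctor.obj (Discrete.mk h)) M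
    exact (Category.assoc _ _ _).trans <| (congrArg (_ ≫ ·) map).trans <|
      (Category.assoc _ _ _).symm.trans <| (congrArg (· ≫ _) tensor).trans <| Category.assoc _ _ _
  unit M := by
    have map := d.map l.toLift.lift.unit M
    exact (Category.assoc _ _ _).trans <| (congrArg (_ ≫ ·) map).trans <|
      (Category.assoc _ _ _).symm.trans <| (congrArg (· ≫ _) (d.unit M)).trans <|
      Category.id_comp _

end Induced

end Condensation

theorem theoremA_general {C : Type u} [Category.{v} C] [Preadditive C] [Linear ℂ C]
    [MonoidalCategory C] [MonoidalPreadditive C] [MonoidalLinear ℂ C] [BraidedCategory C]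
    [HasCoequalizers C] [∀ Z : C, PreservesColimitsOfShape WalkingParallelPair (tensorLeft Z)]
    (A : C) [MonObj A] [IsCommMonObj A] :
    (∀ (p : AutPair A) (M : RMod A), M.IsLocal → ((twist p).obj M).IsLocal) ∧
    ∃ (F : StrongMonoidalFunctor (AutPair A) (AutBr (LocMod A))) (_ : TwistFunctorData F),
      ∀ (G : Type w) [Group G] (ρ : CatAction G C),
        ∃ Φ : ρ.Lift A ≃ ρ.EquivariantAlgebra A,
          (∀ (L : ρ.Lift A) (g : G),
            L.lift.toFunctor.obj (Discrete.mk g) = ⟨ρ.aut g, (Φ L).lam g⟩) ∧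
          ∀ l : ρ.EquivariantAlgebra A, ∃ σ : CatAction G (LocMod A),
            σ = (Φ.symm l).lift.comp F ∧ Nonempty (InducedActionData ρ l σ) := by
  refine ⟨fun p M hM => hM.transportObj p.aut.functor p.lam.iso.inv, twistStrong A,
    twistFunctorData A, fun G _ ρ => ?_⟩
  refine ⟨CatAction.Lift.equivEquivariantAlgebra ρ A, CatAction.Lift.obj_eq, fun l => ?_⟩
  exact ⟨_, rfl, ⟨(twistFunctorData A).induced l⟩⟩

theorem theoremA {C : Type u} [Category.{v} C] [Abelian C] [Linear ℂ C] [MonoidalCategory C]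
    [MonoidalPreadditive C] [MonoidalLinear ℂ C] [RigidCategory C] [BraidedCategory C]
    (hC : IsFusion C) (hnd : IsNondegenerate C)
    (A : C) [MonObj A] [IsCommMonObj A] (hsep : IsSeparableAlgebra A)
    (hconn : IsConnectedAlgebra A) :
    (∀ (p : AutPair A) (M : RMod A), M.IsLocal → ((twist p).obj M).IsLocal) ∧
    ∃ (F : StrongMonoidalFunctor (AutPair A) (AutBr (LocMod A))) (_ : TwistFunctorData F),
      ∀ (G : Type w) [Group G] (ρ : CatAction G C), (∀ g : G, Stab A (ρ.aut g)) →
        ∃ Φ : ρ.Lift A ≃ ρ.EquivariantAlgebra A,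
          (∀ (L : ρ.Lift A) (g : G),
            L.lift.toFunctor.obj (Discrete.mk g) = ⟨ρ.aut g, (Φ L).lam g⟩) ∧
          ∀ l : ρ.EquivariantAlgebra A, ∃ σ : CatAction G (LocMod A),
            σ = (Φ.symm l).lift.comp F ∧ Nonempty (InducedActionData ρ l σ) := by
  obtain ⟨isLocal_twist, F, twistData, lifts⟩ := theoremA_general A
  exact ⟨isLocal_twist, F, twistData, fun G _ ρ _ => lifts G ρ⟩
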